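/- Let $R$ be a commutative $\mathbb C$-algebra (the ring of parameters), $q\in R^\times$, $f\in\mathbb Z$, and let $S=R[\Theta,\Theta^{-1}][[Q^{1/2}]]$ with formal variables $\Theta$ and $Q^{1/2}$. Let $\mathcal F$ be the fermionic Fock space with basis $\underline A=\underline{a_1}\wedge\underline{a_2}\wedge\cdots$ ($a_1>a_2>\cdots$) indexed by the sets $A\subset\mathbb Z+\frac12$ for which the set of positive elements of $A$ and the set of negative half-integers not in $A$ are finite; the difference of the numbers of elements of these two sets is the charge of $\underline A$, and $|0\rangle=\underline{-1/2}\wedge\underline{-3/2}\wedge\cdots$. Let $\psi_r$ (resp. $\psi_r^*$) insert (resp. remove) $\underline r$ with the sign $(-1)^{\#\{a\in A:\,a>r\}}$, the result being $0$ if this is impossible. Let $\psi^i_r,\psi^{i*}_r$ act on the $i$-th factor of a tensor product of copies $\mathcal F_i$ of $\mathcal F$, with the Koszul sign convention (parity of the charge). Vectors are formal, possibly infinite, $S$-linear combinations of basis vectors. For an integer $n$ write $\mathbf n=n+\frac12$. A vector of $\mathcal F_1\otimes\cdots\otimes\mathcal F_N$ is a *Bogoliubov transform* if it has the form $$\exp\Big(\sum_{i,j=1}^N\sum_{m,n\ge0}A^{ij}_{mn}\,\psi^i_{\mathbf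 m}\psi^{j*}_{-\mathbf n}\Big)|0\rangle,\qquad A^{ij}_{mn}\in S$$ (coefficients in $R$, independent of $Q$ and $\Theta$, are included). The gluing vector is $$|P^f_{ab}\rangle=\exp\Big[\sum_{n\ge0}Q^{n+1/2}\big(\Theta\,\epsilon_n\psi^a_{\mathbf n}\psi^{b*}_{-\mathbf n}+\Theta^{-1}\epsilon'_n\psi^b_{\mathbf n}\psi^{a*}_{-\mathbf n}\big)\Big]|0\rangle\in\mathcal F_a\otimes\mathcal F_b,$$ $$\epsilon_n=i^{1+f}(-1)^{(1+f)n}q^{fn(n+1)/2},\qquad \epsilon'_n=i^{1+f}(-1)^{(1+f)n}q^{-fn(n+1)/2}.$$ For a Bogoliubov transform $V\in\mathcal F_1\otimes\cdots\otimes\mathcal F_M\otimes\mathcal F_a\otimes\mathcal F_b$ with coefficients $A^{ij}_{mn}$, the self-gluing is $\tilde G^f(V)=(V,P^f_{ab})\in\mathcal F_1\otimes\cdots\otimes\mathcal F_M$, where the bilinear inner product is taken over $\mathcal F_a\otimes\mathcal F_b$, the basis vectors being orthonormal, and the sum over them is computed separately in each power of $Q^{1/2}$; its closed part is $$\tilde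 G^f(V)_{closed}=\Big(\exp\Big(\sum_{i,j\in\{a,b\}}\sum_{m,n\ge0}A^{ij}_{mn}\psi^i_{\mathbf m}\psi^{j*}_{-\mathbf n}\Big)|0\rangle_{ab},\,P^f_{ab}\Big)\in S,$$ and the normalized self-gluing is $G^f(V)=\tilde G^f(V)/\tilde G^f(V)_{closed}$. For Bogoliubov transforms $V_1\in\mathcal F_1\otimes\cdots\otimes\mathcal F_M\otimes\mathcal F_a$ and $V_2\in\mathcal F_{M+1}\otimes\cdots\otimes\mathcal F_{M+N}\otimes\mathcal F_b$, view $V_1\otimes V_2$ as a vector of $\mathcal F_1\otimes\cdots\otimes\mathcal F_{M+N}\otimes\mathcal F_a\otimes\mathcal F_b$ (reordering the factors with Koszul signs); the normalized gluing is $G^f(V_1,V_2)=G^f(V_1\otimes V_2)$. **Theorem.** Let $M,N\ge0$. 1. For every Bogoliubov transform $V\in\mathcal F_1\otimes\cdots\otimes\mathcal F_M\otimes\mathcal F_a\otimes\mathcal F_b$, the inner products defining $\tilde G^f(V)$ and $\tilde G^f(V)_{closed}$ are well defined (only finitely many basis vectors contribute to each power of $Q^{1/2}$), $\tilde G^f(V)_{closed}$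 is invertible in $S$, and $G^f(V)$ is a Bogoliubov transform in $\mathcal F_1\otimes\cdots\otimes\mathcal F_M$. 2. For all Bogoliubov transforms $V_1\in\mathcal F_1\otimes\cdots\otimes\mathcal F_M\otimes\mathcal F_a$ and $V_2\in\mathcal F_{M+1}\otimes\cdots\otimes\mathcal F_{M+N}\otimes\mathcal F_b$, the vector $V_1\otimes V_2$ is a Bogoliubov transform whose coefficients are those of $V_1$ and $V_2$, with $A^{ij}_{mn}=0$ if $i,j$ do not belong to the same factor; the inner products defining $\tilde G^f(V_1\otimes V_2)$ and $\tilde G^f(V_1\otimes V_2)_{closed}$ are well defined in the same sense, $\tilde G^f(V_1\otimes V_2)_{closed}$ is invertible in $S$, and $G^f(V_1,V_2)$ is a Bogoliubov transform in $\mathcal F_1\otimes\cdots\otimes\mathcal F_{M+N}$. -/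

import Mathlib

noncomputable section

namespace FermionGluing

open scoped Classical Nat LaurentPolynomial PowerSeries

/-! ### Semi-infinite wedges

A half-integer `n + 1/2` is represented by the integer `n`.  Thus the negative half-integers are
`Set.Iio 0`, and `-(n + 1/2)` is represented by `-n - 1`. -/

/-- Admissible sets of half-integers; they index the standard basis of the Fock space. -/
@[ext]
structure Maya where
  carrier : Set ℤ
  holes_finite : (Set.Iio 0 \ carrier).Finite
  particles_finite : (carrier \ Set.Iio 0).Finite

namespace Maya

instance : Membership ℤ Maya := ⟨fun A r => r ∈ A.carrier⟩

/-- The set of all negative half-integers, i.e. the vacuum. -/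
def vacuum : Maya := ⟨Set.Iio 0, by simp, by simp⟩

/-- Add the half-integer `r + 1/2`. -/
def insert (A : Maya) (r : ℤ) : Maya where
  carrier := Insert.insert r A.carrier
  holes_finite := A.holes_finite.subset fun _ hx => ⟨hx.1, fun h => hx.2 (Or.inr h)⟩
  particles_finite := (A.particles_finite.union (Set.finite_singleton r)).subset (by
    rintro x ⟨hx | hx, h⟩
    · exact Or.inr hx
    · exact Or.inl ⟨hx, h⟩)

/-- Remove the half-integer `r + 1/2`. -/
def erase (A : Maya) (r : ℤ) : Maya where
  carrier := A.carrier \ {r}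
  holes_finite := (A.holes_finite.union (Set.finite_singleton r)).subset (by
    rintro x ⟨hx, h⟩
    by_cases hr : x = r
    · exact Or.inr hr
    · exact Or.inl ⟨hx, fun h' => h ⟨h', hr⟩⟩)
  particles_finite := A.particles_finite.subset fun _ hx => ⟨hx.1.1, hx.2⟩

/-- The charge `|A \ ℤ₋+1/2| - |ℤ₋+1/2 \ A|`. -/
def charge (A : Maya) : ℤ := ((A.carrier \ Set.Iio 0).ncard : ℤ) - ((Set.Iio 0 \ A.carrier).ncard : ℤ)

/-- The number of elements of `A` above `r + 1/2`, i.e. the number of factors that stand before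
the position of `r + 1/2` in the wedge `a₁ ∧ a₂ ∧ ⋯`. -/
def above (A : Maya) (r : ℤ) : ℕ := {a : ℤ | a ∈ A.carrier ∧ r < a}.ncard

end Maya

/-- Basis states of the `N`-component Fock space. -/
abbrev States (N : ℕ) : Type := Fin N → Maya

/-- The (completed) `N`-component fermionic Fock space `F₁ ⊗ ⋯ ⊗ F_N` over `S`: formal, possibly
infinite, linear combinations of basis states, given by their coefficients. -/
abbrev Fock (N : ℕ) (S : Type*) : Type _ := States N → S

section Operators

variable {N : ℕ} {S : Type*} [CommRing S]

/-- The vacuum `|0⟩ ⊗ ⋯ ⊗ |0⟩`. -/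
def vac : Fock N S := Pi.single (fun _ => Maya.vacuum) 1

/-- The sign with which `ψ^i_r` and `ψ^{i*}_r` act: the Koszul sign for passing the components
before the `i`-th one, times the sign of the position of `r + 1/2` in the `i`-th wedge. -/
def sgn (A : States N) (i : Fin N) (r : ℤ) : ℤˣ :=
  Int.negOnePow (∑ j ∈ Finset.Iio i, (A j).charge + (A i).above r)

/-- The state with `r + 1/2` added to the `i`-th component. -/
def add (A : States N) (i : Fin N) (r : ℤ) : States N := Function.update A i ((A i).insert r)

/-- The state with `r + 1/2` removed from the `i`-th component. -/
def remove (A : States N) (i : Fin N) (r : ℤ) : States N := Function.update A i ((A i).erase r)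

/-- The operator `ψ^i_{r+1/2}`; see `psi_single` for its effect on basis states. -/
def psi (i : Fin N) (r : ℤ) : Fock N S →ₗ[S] Fock N S where
  toFun V := fun A => if r ∈ A i then ((sgn A i r : ℤ) : S) * V (remove A i r) else 0
  map_add' V W := by ext A; by_cases h : r ∈ A i <;> simp [h, mul_add]
  map_smul' c V := by ext A; by_cases h : r ∈ A i <;> simp [h, mul_left_comm]

/-- The operator `ψ^{i*}_{r+1/2}`; see `psiStar_single` for its effect on basis states. -/
def psiStar (i : Fin N) (r : ℤ) : Fock N S →ₗ[S] Fock N S where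
  toFun V := fun A => if r ∈ A i then 0 else ((sgn A i r : ℤ) : S) * V (add A i r)
  map_add' V W := by ext A; by_cases h : r ∈ A i <;> simp [h, mul_add]
  map_smul' c V := by ext A; by_cases h : r ∈ A i <;> simp [h, mul_left_comm]

theorem mem_add_self (A : States N) (i : Fin N) (r : ℤ) : r ∈ add A i r i := by
  show r ∈ (add A i r i).carrier
  simp [add, Maya.insert]

theorem notMem_remove_self (A : States N) (i : Fin N) (r : ℤ) : r ∉ remove A i r i := by
  show r ∉ (remove A i r i).carrier
  simp [remove, Maya.erase]

theorem remove_add (A : States N) (i : Fin N) (r : ℤ) (h : r ∉ A i) :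
    remove (add A i r) i r = A := by
  unfold remove add
  rw [Function.update_idem, Function.update_eq_iff]
  refine ⟨Maya.ext ?_, fun _ _ => rfl⟩
  have h' : r ∉ (A i).carrier := h
  simp [Maya.erase, Maya.insert, h']

theorem add_remove (A : States N) (i : Fin N) (r : ℤ) (h : r ∈ A i) :
    add (remove A i r) i r = A := by
  unfold remove add
  rw [Function.update_idem, Function.update_eq_iff]
  refine ⟨Maya.ext ?_, fun _ _ => rfl⟩
  have h' : r ∈ (A i).carrier := h
  simp [Maya.erase, Maya.insert, h']

theorem sgn_add (A : States N) (i : Fin N) (r : ℤ) : sgn (add A i r) i r = sgn A i r := by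
  have h1 : ∑ j ∈ Finset.Iio i, (add A i r j).charge = ∑ j ∈ Finset.Iio i, (A j).charge := by
    refine Finset.sum_congr rfl fun j hj => ?_
    rw [add, Function.update_of_ne (Finset.mem_Iio.1 hj).ne]
  have h2 : (add A i r i).above r = (A i).above r := by
    unfold Maya.above
    congr 1
    ext a
    simp only [add, Function.update_self, Maya.insert, Set.mem_ofPred_eq, Set.mem_insert_iff]
    constructor
    · rintro ⟨rfl | h, h'⟩
      · exact absurd h' (lt_irrefl _)
      · exact ⟨h, h'⟩
    · exact fun h => ⟨Or.inr h.1, h.2⟩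
  rw [sgn, sgn, h1, h2]

theorem sgn_remove (A : States N) (i : Fin N) (r : ℤ) (h : r ∈ A i) :
    sgn (remove A i r) i r = sgn A i r := by
  rw [← sgn_add (remove A i r), add_remove A i r h]

/-- `ψ^i_r` inserts `r` into the `i`-th wedge, with sign, and kills the states that contain it. -/
theorem psi_single (i : Fin N) (r : ℤ) (B : States N) :
    psi i r (Pi.single B (1 : S)) =
      if r ∈ B i then 0 else ((sgn B i r : ℤ) : S) • Pi.single (add B i r) 1 := by
  ext A
  simp only [psi, LinearMap.coe_mk, AddHom.coe_mk]
  by_cases hB : r ∈ B i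
  · rw [if_pos hB, Pi.zero_apply]
    split_ifs with hA
    · have : remove A i r ≠ B := by
        rintro rfl; exact notMem_remove_self A i r hB
      simp [this]
    · rfl
  · rw [if_neg hB, Pi.smul_apply]
    by_cases hAB : A = add B i r
    · subst hAB
      rw [if_pos (mem_add_self B i r), remove_add B i r hB, sgn_add]
      simp
    · rw [Pi.single_eq_of_ne hAB, smul_zero]
      split_ifs with hA
      · have : remove A i r ≠ B := by
          rintro rfl; exact hAB (add_remove A i r hA).symm
        simp [this]
      · rfl

/-- `ψ^{i*}_r` removes `r` from the `i`-th wedge, with sign, and kills the states without it. -/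
theorem psiStar_single (i : Fin N) (r : ℤ) (B : States N) :
    psiStar i r (Pi.single B (1 : S)) =
      if r ∈ B i then ((sgn B i r : ℤ) : S) • Pi.single (remove B i r) 1 else 0 := by
  ext A
  simp only [psiStar, LinearMap.coe_mk, AddHom.coe_mk]
  by_cases hB : r ∈ B i
  · rw [if_pos hB, Pi.smul_apply]
    by_cases hAB : A = remove B i r
    · subst hAB
      rw [if_neg (notMem_remove_self B i r), add_remove B i r hB, sgn_remove B i r hB]
      simp
    · rw [Pi.single_eq_of_ne hAB, smul_zero]
      split_ifs with hA
      · rfl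
      · have : add A i r ≠ B := by
          rintro rfl; exact hAB (remove_add A i r hA).symm
        simp [this]
  · rw [if_neg hB, Pi.zero_apply]
    split_ifs with hA
    · rfl
    · have : add A i r ≠ B := by
        rintro rfl; exact hB (mem_add_self A i r)
      simp [this]

/-- Families of coefficients `A^{ij}_{mn}`, `m, n ≥ 0`. -/
abbrev Coeffs (N : ℕ) (S : Type*) : Type _ := Fin N → Fin N → ℕ → ℕ → S

/-- The term `A^{ij}_{mn} ψ^i_{m+1/2} ψ^{j*}_{-(n+1/2)} V`, for `p = (i, j, m, n)`. -/
def quadTerm (A : Coeffs N S) (V : Fock N S) (p : Fin N × Fin N × ℕ × ℕ) : Fock N S :=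
  A p.1 p.2.1 p.2.2.1 p.2.2.2 • psi p.1 (p.2.2.1 : ℤ) (psiStar p.2.1 (-(p.2.2.2 : ℤ) - 1) V)

/-- The quadratic expression `∑_{i,j} ∑_{m,n ≥ 0} A^{ij}_{mn} ψ^i_{m+1/2} ψ^{j*}_{-(n+1/2)}` in the
fermionic creators, as an operator on the completed Fock space.  By `quadTerm_finite` each
coefficient is a finite sum. -/
def quad (A : Coeffs N S) (V : Fock N S) : Fock N S :=
  fun T => ∑ᶠ p : Fin N × Fin N × ℕ × ℕ, quadTerm A V p T

theorem quadTerm_ne_zero {A : Coeffs N S} {V : Fock N S} {p : Fin N × Fin N × ℕ × ℕ}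
    {T : States N} (h : quadTerm A V p T ≠ 0) :
    (p.2.2.1 : ℤ) ∈ T p.1 ∧ (-(p.2.2.2 : ℤ) - 1) ∉ T p.2.1 ∧
      V (add (remove T p.1 p.2.2.1) p.2.1 (-(p.2.2.2 : ℤ) - 1)) ≠ 0 := by
  obtain ⟨i, j, m, n⟩ := p
  simp only [quadTerm, psi, psiStar, LinearMap.coe_mk, AddHom.coe_mk, Pi.smul_apply,
    smul_eq_mul] at h
  by_cases h1 : (m : ℤ) ∈ T i
  · rw [if_pos h1] at h
    by_cases h2 : (-(n : ℤ) - 1) ∈ remove T i m j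
    · simp [h2] at h
    · rw [if_neg h2] at h
      refine ⟨h1, fun h3 => h2 ?_, fun h3 => h (by simp [h3])⟩
      show (-(n : ℤ) - 1) ∈ (remove T i m j).carrier
      by_cases hij : j = i
      · subst hij
        simp only [remove, Function.update_self, Maya.erase]
        refine ⟨h3, ?_⟩
        simp only [Set.mem_singleton_iff]
        omega
      · rw [remove, Function.update_of_ne hij]
        exact h3
  · simp [h1] at h

theorem quadTerm_finite (A : Coeffs N S) (V : Fock N S) (T : States N) :
    (Function.support fun p => quadTerm A V p T).Finite := by
  have hm : ∀ i, {m : ℕ | (m : ℤ) ∈ T i}.Finite := fun i =>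
    Set.Finite.subset ((T i).particles_finite.preimage (f := fun m : ℕ => (m : ℤ))
      (fun _ _ _ _ h => by simpa using h)) fun m hm => ⟨hm, by simp⟩
  have hn : ∀ j, {n : ℕ | (-(n : ℤ) - 1) ∉ T j}.Finite := fun j =>
    Set.Finite.subset ((T j).holes_finite.preimage (f := fun n : ℕ => (-(n : ℤ) - 1))
      (fun _ _ _ _ h => by simpa using h)) fun n hn => ⟨by
        simp only [Set.mem_Iio]; omega, hn⟩
  refine ((Set.finite_univ (α := Fin N)).prod ((Set.finite_univ (α := Fin N)).prod
    ((Set.finite_iUnion hm).prod (Set.finite_iUnion hn)))).subset ?_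
  rintro ⟨i, j, m, n⟩ hp
  obtain ⟨h1, h2, -⟩ := quadTerm_ne_zero hp
  exact ⟨trivial, trivial, Set.mem_iUnion.2 ⟨i, h1⟩, Set.mem_iUnion.2 ⟨j, h2⟩⟩

/-- The number of positive half-integers in a state. -/
def particles (T : States N) : ℕ := ∑ i, ((T i).carrier \ Set.Iio 0).ncard

theorem particles_quad (T : States N) (i j : Fin N) (m n : ℕ) (h1 : (m : ℤ) ∈ T i) :
    particles T = particles (add (remove T i m) j (-(n : ℤ) - 1)) + 1 := by
  have hadd : ∀ U : States N, particles (add U j (-(n : ℤ) - 1)) = particles U := by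
    intro U
    refine Finset.sum_congr rfl fun l _ => ?_
    by_cases hl : l = j
    · subst hl
      simp only [add, Function.update_self, Maya.insert]
      rw [Set.insert_sdiff_of_mem _ (by simp only [Set.mem_Iio]; omega)]
    · rw [add, Function.update_of_ne hl]
  rw [hadd, particles, particles, ← Finset.add_sum_erase _ _ (Finset.mem_univ i),
    ← Finset.add_sum_erase _ _ (Finset.mem_univ i)]
  have hrest : ∑ l ∈ Finset.univ.erase i, ((remove T i m l).carrier \ Set.Iio 0).ncard
      = ∑ l ∈ Finset.univ.erase i, ((T l).carrier \ Set.Iio 0).ncard := by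
    refine Finset.sum_congr rfl fun l hl => ?_
    rw [remove, Function.update_of_ne (Finset.ne_of_mem_erase hl)]
  have hi : ((remove T i m i).carrier \ Set.Iio 0).ncard + 1 = ((T i).carrier \ Set.Iio 0).ncard := by
    have hs : (remove T i m i).carrier \ Set.Iio 0 = ((T i).carrier \ Set.Iio 0) \ {(m : ℤ)} := by
      simp only [remove, Function.update_self, Maya.erase]
      rw [Set.sdiff_sdiff_comm]
    have hmem : (m : ℤ) ∈ (T i).carrier \ Set.Iio 0 := ⟨h1, by simp⟩
    rw [hs, Set.ncard_sdiff_singleton_add_one hmem (T i).particles_finite]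
  rw [hrest, ← hi]
  omega

theorem quad_iterate_vac_ne_zero (A : Coeffs N S) (k : ℕ) :
    ∀ T : States N, (quad A)^[k] vac T ≠ 0 → particles T = k := by
  induction k with
  | zero =>
    intro T hT
    have : T = fun _ => Maya.vacuum := by
      by_contra hne
      exact hT (Pi.single_eq_of_ne hne _)
    subst this
    simp [particles, Maya.vacuum]
  | succ k ih =>
    intro T hT
    rw [Function.iterate_succ_apply'] at hT
    obtain ⟨p, hp⟩ : ∃ p, quadTerm A ((quad A)^[k] vac) p T ≠ 0 := by
      by_contra! h
      exact hT (by simp [quad, h])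
    obtain ⟨h1, -, h3⟩ := quadTerm_ne_zero hp
    rw [particles_quad T p.1 p.2.1 p.2.2.1 p.2.2.2 h1, ih _ h3]

variable [Algebra ℂ S]

/-- The vector `exp(∑_{i,j} ∑_{m,n ≥ 0} A^{ij}_{mn} ψ^i_{m+1/2} ψ^{j*}_{-(n+1/2)}) |0⟩`.
By `quad_iterate_vac_finite` each coefficient is a finite sum. -/
def bogoliubov (A : Coeffs N S) : Fock N S :=
  fun T => ∑ᶠ k : ℕ, ((k ! : ℂ)⁻¹) • ((quad A)^[k] vac T)

theorem quad_iterate_vac_finite (A : Coeffs N S) (T : States N) :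
    (Function.support fun k : ℕ => ((k ! : ℂ)⁻¹) • ((quad A)^[k] vac T)).Finite := by
  refine (Set.finite_singleton (particles T)).subset fun k hk => ?_
  refine (quad_iterate_vac_ne_zero A k T fun h => hk ?_).symm
  show ((k ! : ℂ)⁻¹) • ((quad A)^[k] vac T) = 0
  rw [h, smul_zero]

/-- `V` is a Bogoliubov transform of the vacuum. -/
def IsBogoliubov (V : Fock N S) : Prop := ∃ A : Coeffs N S, V = bogoliubov A

end Operators

/-! ### The gluing vectors -/

section Gluing

variable {R : Type*} [CommRing R] [Algebra ℂ R]

/-- The ring `R[Θ, Θ⁻¹]⟦Q^{1/2}⟧`; the power series variable is `Q^{1/2}`. -/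
abbrev GlueRing (R : Type*) [CommRing R] : Type _ := R[T;T⁻¹]⟦X⟧

/-- `ε_n = i^{1+f} (-1)^{(1+f)n} q^{f n(n+1)/2}`. -/
def eps (q : Rˣ) (f : ℤ) (n : ℕ) : R :=
  algebraMap ℂ R (Complex.I ^ (1 + f) * (-1) ^ ((1 + f) * n)) *
    ((q ^ (f * ((n * (n + 1) / 2 : ℕ) : ℤ)) : Rˣ) : R)

/-- `ε'_n = i^{1+f} (-1)^{(1+f)n} q^{-f n(n+1)/2}`. -/
def eps' (q : Rˣ) (f : ℤ) (n : ℕ) : R :=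
  algebraMap ℂ R (Complex.I ^ (1 + f) * (-1) ^ ((1 + f) * n)) *
    ((q ^ (-(f * ((n * (n + 1) / 2 : ℕ) : ℤ))) : Rˣ) : R)

/-- The coefficients in the exponent of the gluing vector; the components `a`, `b` are `0`, `1`,
and `Q^{n+1/2}` is `X^(2n+1)`. -/
def glueCoeffs (q : Rˣ) (f : ℤ) : Coeffs 2 (GlueRing R) := fun i j m n =>
  if m = n then
    if i = 0 ∧ j = 1 then
      PowerSeries.X ^ (2 * n + 1) *
        PowerSeries.C (LaurentPolynomial.T 1 * LaurentPolynomial.C (eps q f n))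
    else if i = 1 ∧ j = 0 then
      PowerSeries.X ^ (2 * n + 1) *
        PowerSeries.C (LaurentPolynomial.T (-1) * LaurentPolynomial.C (eps' q f n))
    else 0
  else 0

/-- The gluing vector `|P^f_{ab}⟩`. -/
def glueVector (q : Rˣ) (f : ℤ) : Fock 2 (GlueRing R) := bogoliubov (glueCoeffs q f)

/-- The inner product on `F_a ⊗ F_b` for which the basis states are orthonormal, extended
bilinearly and `Q`-adically: the coefficient of each power of `Q^{1/2}` is summed separately. -/
def pairing (U P : Fock 2 (GlueRing R)) : GlueRing R :=
  PowerSeries.mk fun k => ∑ᶠ T : States 2, PowerSeries.coeff k (U T * P T)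

/-- The inner product `pairing U P` is well defined: only finitely many basis states contribute
to each power of `Q^{1/2}`. -/
def PairingConverges (U P : Fock 2 (GlueRing R)) : Prop :=
  ∀ k : ℕ, (Function.support fun T : States 2 => PowerSeries.coeff k (U T * P T)).Finite

variable {M N : ℕ}

/-- The part of `V ∈ F₁ ⊗ ⋯ ⊗ F_M ⊗ F_a ⊗ F_b` along the basis state `T` of `F₁ ⊗ ⋯ ⊗ F_M`. -/
def slice (V : Fock (M + 2) (GlueRing R)) (T : States M) : Fock 2 (GlueRing R) :=
  fun U => V (Fin.append T U)

/-- The self-gluing `(V, P^f_{ab})`, an inner product over the last two components. -/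
def selfGluing (q : Rˣ) (f : ℤ) (V : Fock (M + 2) (GlueRing R)) : Fock M (GlueRing R) :=
  fun T => pairing (slice V T) (glueVector q f)

/-- The coefficients `A^{ij}_{mn}` with `i, j ∈ {a, b}`. -/
def restrictAB (A : Coeffs (M + 2) (GlueRing R)) : Coeffs 2 (GlueRing R) :=
  fun i j => A (Fin.natAdd M i) (Fin.natAdd M j)

/-- The closed part of the self-gluing of `bogoliubov A`. -/
def closedPart (q : Rˣ) (f : ℤ) (A : Coeffs (M + 2) (GlueRing R)) : GlueRing R :=
  pairing (bogoliubov (restrictAB A)) (glueVector q f)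

/-- The normalized self-gluing of `V`, where `V = bogoliubov A`. -/
def normalizedSelfGluing (q : Rˣ) (f : ℤ) (V : Fock (M + 2) (GlueRing R))
    (A : Coeffs (M + 2) (GlueRing R)) : Fock M (GlueRing R) :=
  Ring.inverse (closedPart q f A) • selfGluing q f V

/-- The tensor product of `V₁ ∈ F₁ ⊗ ⋯ ⊗ F_M ⊗ F_a` and `V₂ ∈ F_{M+1} ⊗ ⋯ ⊗ F_{M+N} ⊗ F_b`, as a
vector of `F₁ ⊗ ⋯ ⊗ F_{M+N} ⊗ F_a ⊗ F_b`: the factor `F_a` is moved past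
`F_{M+1} ⊗ ⋯ ⊗ F_{M+N}` with the Koszul sign. -/
def tensor (V₁ : Fock (M + 1) (GlueRing R)) (V₂ : Fock (N + 1) (GlueRing R)) :
    Fock (M + N + 2) (GlueRing R) := fun T =>
  let T₁ : States M := fun i => T (Fin.castAdd 2 (Fin.castAdd N i))
  let T₂ : States N := fun j => T (Fin.castAdd 2 (Fin.natAdd M j))
  let Ta : Maya := T (Fin.natAdd (M + N) 0)
  let Tb : Maya := T (Fin.natAdd (M + N) 1)
  ((Int.negOnePow (Ta.charge * ∑ j, (T₂ j).charge) : ℤ) : GlueRing R) *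
    (V₁ (Fin.snoc (α := fun _ => Maya) T₁ Ta) * V₂ (Fin.snoc (α := fun _ => Maya) T₂ Tb))

/-- The position of a component of `F₁ ⊗ ⋯ ⊗ F_{M+N} ⊗ F_a ⊗ F_b` in
`F₁ ⊗ ⋯ ⊗ F_M ⊗ F_a` or in `F_{M+1} ⊗ ⋯ ⊗ F_{M+N} ⊗ F_b`. -/
def side (i : Fin (M + N + 2)) : Fin (M + 1) ⊕ Fin (N + 1) :=
  Fin.append (Fin.append (fun i : Fin M => Sum.inl i.castSucc)
    (fun j : Fin N => Sum.inr j.castSucc)) ![Sum.inl (Fin.last M), Sum.inr (Fin.last N)] i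

/-- The coefficients of the tensor product of two Bogoliubov transforms: `A^{ij}_{mn} = 0` unless
`i` and `j` belong to the same factor. -/
def blockCoeffs (A₁ : Coeffs (M + 1) (GlueRing R)) (A₂ : Coeffs (N + 1) (GlueRing R)) :
    Coeffs (M + N + 2) (GlueRing R) := fun i j =>
  match side i, side j with
  | Sum.inl i', Sum.inl j' => A₁ i' j'
  | Sum.inr i', Sum.inr j' => A₂ i' j'
  | _, _ => fun _ _ => 0

end Gluing

end FermionGluing

end

noncomputable section

namespace FermionGluing

open scoped Classical Nat LaurentPolynomial PowerSeries

/-! A Bogoliubov transform is recognized by its annihilators. Commuting `ψ^{i*}_m` past the exponent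
gives the relations `ψ^{i*}_m V = ∑ A^{ij}_{mn} ψ^{j*}_{-n} V` (`psiStar_bogoliubov`; half-integer
shifts suppressed). Conversely, these relations express each coefficient through coefficients of
states with fewer particles. Hence a vector satisfying them, whose only possibly nonzero coefficient
among particle-free states is at the vacuum, is a multiple of the transform (`eq_smul_bogoliubov`).
Both parts of the theorem reduce to producing such relations.

For the self-gluing `W = (V, P)`, pairing commutes with `ψ^*` on the external components. On `a` and
`b` the adjoint of `ψ^*` is `ψ`, and `P` obeys the dual relations `psi_glueVector`. Therefore
`(ψ^{c*}_{-n} V, P)` equals a combination of the vectors `(ψ^{d*}_n V, P)`, with coefficients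
divisible by `X` (`selfGluing_psiStar_hole`). The relations of `V` turn these back into sums of
`(ψ^{j*}_{-l} V, P)`, where external `j` give `ψ^{j*}_{-l} W`. Each round over `a, b` gains a power
of `X`, so every `(ψ^{i*}_m V, P)` is a combination of the vectors `ψ^{j*}_{-l} W` with external
`j`.

No infinite linear system is solved: the coefficients of such a combination can be read off at the
states with one hole. The functional `holeDefect` measures the resulting error; it kills every
`ψ^{j*}_{-l} W`, and the recursion makes its value on `(ψ^{i*}_m V, P)` divisible by all powers of
`X`, hence zero (`psiStar_selfGluing_bogoliubov`).

The vacuum coefficient of `W` is the closed part, invertible because `P` is the vacuum modulo `X`.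
Convergence holds because the coefficients of `P` tend to zero adically. For two transforms, the
annihilator relations pass to the tensor product with a common sign (`tensor_bogoliubov`), which
reduces gluing to self-gluing. -/

theorem Iio_eq_filter_univ {n : ℕ} (i : Fin n) : Finset.Iio i = Finset.univ.filter (· < i) := by
  ext
  simp

/-! ### Toggling an element of a state -/

section Toggle

variable {N : ℕ}

theorem States.ext {T U : States N} (h : ∀ i r, r ∈ T i ↔ r ∈ U i) : T = U :=
  funext fun i => Maya.ext (Set.ext fun r => h i r)

theorem mem_add {T : States N} {i j : Fin N} {r s : ℤ} :
    s ∈ add T i r j ↔ (i = j ∧ s = r) ∨ s ∈ T j := by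
  show s ∈ (add T i r j).carrier ↔ _ ∨ s ∈ (T j).carrier
  by_cases h : j = i
  · subst h
    simp [add, Maya.insert]
  · rw [add, Function.update_of_ne h]
    simp [Ne.symm h]

theorem mem_remove {T : States N} {i j : Fin N} {r s : ℤ} :
    s ∈ remove T i r j ↔ ¬(i = j ∧ s = r) ∧ s ∈ T j := by
  show s ∈ (remove T i r j).carrier ↔ _ ∧ s ∈ (T j).carrier
  by_cases h : j = i
  · subst h
    simp [remove, Maya.erase, and_comm]
  · rw [remove, Function.update_of_ne h]
    simp [Ne.symm h]

theorem mem_vacuum {r : ℤ} : r ∈ Maya.vacuum ↔ r < 0 := Iff.rfl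

/-- Remove `r + 1/2` from the `i`-th component if it is there, and add it otherwise. -/
def toggle (T : States N) (i : Fin N) (r : ℤ) : States N :=
  if r ∈ T i then remove T i r else add T i r

theorem mem_toggle {T : States N} {i j : Fin N} {r s : ℤ} :
    s ∈ toggle T i r j ↔ (s ∈ T j ↔ ¬(i = j ∧ s = r)) := by
  unfold toggle
  split_ifs with h
  · rw [mem_remove]
    constructor
    · tauto
    · intro h'
      by_cases hc : i = j ∧ s = r
      · obtain ⟨rfl, rfl⟩ := hc
        tauto
      · tauto
  · rw [mem_add]
    constructor
    · rintro (⟨rfl, rfl⟩ | h') <;> [tauto; skip]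
      refine iff_of_true h' ?_
      rintro ⟨rfl, rfl⟩
      exact h h'
    · tauto

/-- Toggles commute without signs, so the anticommutation relations become statements about `sgn`
alone. -/
theorem toggle_comm (T : States N) (i j : Fin N) (r s : ℤ) :
    toggle (toggle T i r) j s = toggle (toggle T j s) i r :=
  States.ext fun k t => by simp only [mem_toggle]; tauto

theorem toggle_toggle (T : States N) (i : Fin N) (r : ℤ) : toggle (toggle T i r) i r = T :=
  States.ext fun k t => by simp only [mem_toggle]; tauto

theorem Maya.charge_insert (A : Maya) {r : ℤ} (h : r ∉ A) : (A.insert r).charge = A.charge + 1 := by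
  have h' : r ∉ A.carrier := h
  unfold Maya.charge
  by_cases hr : r < 0
  · have h1 : (A.insert r).carrier \ Set.Iio 0 = A.carrier \ Set.Iio 0 :=
      Set.insert_sdiff_of_mem _ hr
    have h2 : Set.Iio 0 \ (A.insert r).carrier = (Set.Iio 0 \ A.carrier) \ {r} := by
      ext x; simp only [Maya.insert, Set.mem_sdiff, Set.mem_insert_iff, Set.mem_singleton_iff]; tauto
    have h3 := Set.ncard_sdiff_singleton_add_one (s := Set.Iio 0 \ A.carrier) (a := r) ⟨hr, h'⟩
      A.holes_finite
    rw [h1, h2]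
    omega
  · have h1 : (A.insert r).carrier \ Set.Iio 0 = Insert.insert r (A.carrier \ Set.Iio 0) :=
      Set.insert_sdiff_of_notMem _ hr
    have h2 : Set.Iio 0 \ (A.insert r).carrier = Set.Iio 0 \ A.carrier := by
      ext x
      simp only [Maya.insert, Set.mem_sdiff, Set.mem_insert_iff, Set.mem_Iio, not_or]
      constructor
      · tauto
      · rintro ⟨hx, hx'⟩
        exact ⟨hx, by rintro rfl; exact hr hx, hx'⟩
    rw [h1, h2, Set.ncard_insert_of_notMem (fun hx => h' hx.1) A.particles_finite]
    push_cast
    ring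

theorem Maya.above_finite (A : Maya) (r : ℤ) : {a : ℤ | a ∈ A.carrier ∧ r < a}.Finite := by
  refine (A.particles_finite.union (Set.finite_Ioo r 0)).subset ?_
  rintro a ⟨ha, hr⟩
  by_cases h : a < 0
  · exact Or.inr ⟨hr, h⟩
  · exact Or.inl ⟨ha, h⟩

theorem Maya.above_insert (A : Maya) {r : ℤ} (h : r ∉ A) (s : ℤ) :
    (A.insert r).above s = A.above s + if s < r then 1 else 0 := by
  unfold Maya.above
  split_ifs with hs
  · have : {a : ℤ | a ∈ (A.insert r).carrier ∧ s < a}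
        = Insert.insert r {a : ℤ | a ∈ A.carrier ∧ s < a} := by
      ext x
      simp only [Maya.insert, Set.mem_insert_iff, Set.mem_ofPred_eq]
      constructor
      · tauto
      · rintro (rfl | h) <;> tauto
    rw [this, Set.ncard_insert_of_notMem (fun hx => h hx.1) (A.above_finite s)]
  · congr 1
    ext x
    simp only [Maya.insert, Set.mem_insert_iff, Set.mem_ofPred_eq]
    constructor
    · rintro ⟨rfl | h, h'⟩ <;> tauto
    · tauto

theorem charge_add {T : States N} {i : Fin N} {r : ℤ} (h : r ∉ T i) (j : Fin N) :
    (add T i r j).charge = (T j).charge + if i = j then 1 else 0 := by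
  by_cases hj : j = i
  · subst hj
    simp [add, Maya.charge_insert _ h]
  · rw [add, Function.update_of_ne hj]
    simp [Ne.symm hj]

theorem above_add {T : States N} {i : Fin N} {r : ℤ} (h : r ∉ T i) (j : Fin N) (s : ℤ) :
    (add T i r j).above s = (T j).above s + if i = j ∧ s < r then 1 else 0 := by
  by_cases hj : j = i
  · subst hj
    simp [add, Maya.above_insert _ h]
  · rw [add, Function.update_of_ne hj]
    simp [Ne.symm hj]

/-- A new element is passed by operators on later components (Koszul sign) and by those at lower
positions in the same component. -/
theorem sgn_add_other {T : States N} {i : Fin N} {r : ℤ} (h : r ∉ T i) (j : Fin N) (s : ℤ) :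
    sgn (add T i r) j s = if i < j ∨ (i = j ∧ s < r) then - sgn T j s else sgn T j s := by
  unfold sgn
  simp only [charge_add h, above_add h, Finset.sum_add_distrib, Finset.sum_ite_eq,
    Finset.mem_Iio]
  split_ifs with h1 h2 h3 h3 h3
  all_goals first
    | (exfalso; omega)
    | (push_cast; rw [← Int.negOnePow_succ]; congr 1; ring)
    | (push_cast; congr 1; ring)

theorem sgn_toggle (T : States N) (i : Fin N) (r : ℤ) (j : Fin N) (s : ℤ) :
    sgn (toggle T i r) j s = if i < j ∨ (i = j ∧ s < r) then - sgn T j s else sgn T j s := by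
  unfold toggle
  split_ifs with h1 h2 h2
  · conv_rhs => rw [← add_remove T i r h1]
    rw [sgn_add_other (notMem_remove_self T i r), if_pos h2, neg_neg]
  · conv_rhs => rw [← add_remove T i r h1]
    rw [sgn_add_other (notMem_remove_self T i r), if_neg h2]
  · rw [sgn_add_other h1, if_pos h2]
  · rw [sgn_add_other h1, if_neg h2]

theorem sgn_toggle_self (T : States N) (i : Fin N) (r : ℤ) :
    sgn (toggle T i r) i r = sgn T i r := by
  rw [sgn_toggle, if_neg (by simp)]

/-- Of two distinct positions exactly one precedes the other, so exactly one of the two orders of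
toggling picks up a sign. -/
theorem sgn_mul_sgn_toggle (T : States N) {i j : Fin N} {r s : ℤ} (h : ¬(i = j ∧ s = r)) :
    sgn T i r * sgn (toggle T i r) j s = -(sgn T j s * sgn (toggle T j s) i r) := by
  rw [sgn_toggle, sgn_toggle]
  have h' : (i < j ∨ (i = j ∧ s < r)) ↔ ¬(j < i ∨ (j = i ∧ r < s)) := by omega
  by_cases hc : j < i ∨ (j = i ∧ r < s)
  · rw [if_pos hc, if_neg (fun h => h'.1 h hc), mul_neg, neg_neg, mul_comm]
  · rw [if_neg hc, if_pos (h'.2 hc), mul_neg, mul_comm]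

theorem sgn_mul_self (T : States N) (i : Fin N) (r : ℤ) (S : Type*) [Ring S] :
    ((sgn T i r : ℤ) : S) * ((sgn T i r : ℤ) : S) = 1 := by
  rw [← Int.cast_mul, ← Units.val_mul, Int.units_mul_self]
  simp

end Toggle

/-! ### Canonical anticommutation relations -/

section CAR

variable {N : ℕ} {S : Type*} [CommRing S]

theorem psi_apply (i : Fin N) (r : ℤ) (V : Fock N S) (T : States N) :
    psi i r V T = if r ∈ T i then ((sgn T i r : ℤ) : S) * V (toggle T i r) else 0 := by
  show (if r ∈ T i then _ else _) = _
  split_ifs with h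
  · rw [toggle, if_pos h]
  · rfl

theorem psiStar_apply (i : Fin N) (r : ℤ) (V : Fock N S) (T : States N) :
    psiStar i r V T = if r ∈ T i then 0 else ((sgn T i r : ℤ) : S) * V (toggle T i r) := by
  show (if r ∈ T i then _ else _) = _
  split_ifs with h
  · rfl
  · rw [toggle, if_neg h]

theorem sgn_mul_sgn_toggle_mul (T : States N) {i j : Fin N} {r s : ℤ} (h : ¬(i = j ∧ s = r))
    (x : S) :
    ((sgn T i r : ℤ) : S) * (((sgn (toggle T i r) j s : ℤ) : S) * x) =
      -(((sgn T j s : ℤ) : S) * (((sgn (toggle T j s) i r : ℤ) : S) * x)) := by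
  rw [← mul_assoc, ← mul_assoc, ← Int.cast_mul, ← Int.cast_mul, ← Units.val_mul, ← Units.val_mul,
    sgn_mul_sgn_toggle T h]
  simp

theorem psiStar_psiStar (i j : Fin N) (r s : ℤ) (V : Fock N S) :
    psiStar i r (psiStar j s V) = - psiStar j s (psiStar i r V) := by
  ext T
  simp only [Pi.neg_apply, psiStar_apply, mem_toggle]
  by_cases h : i = j ∧ s = r
  · obtain ⟨rfl, rfl⟩ := h
    by_cases h' : s ∈ T i <;> simp [h']
  · have h2 : ¬(j = i ∧ r = s) := fun hh => h ⟨hh.1.symm, hh.2.symm⟩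
    simp only [h, h2, not_false_eq_true, iff_true]
    by_cases h3 : r ∈ T i <;> by_cases h4 : s ∈ T j <;>
      simp only [h3, h4, if_true, if_false, mul_zero, neg_zero]
    rw [sgn_mul_sgn_toggle_mul T h, toggle_comm]

theorem psi_psi (i j : Fin N) (r s : ℤ) (V : Fock N S) :
    psi i r (psi j s V) = - psi j s (psi i r V) := by
  ext T
  simp only [Pi.neg_apply, psi_apply, mem_toggle]
  by_cases h : i = j ∧ s = r
  · obtain ⟨rfl, rfl⟩ := h
    by_cases h' : s ∈ T i <;> simp [h']
  · have h2 : ¬(j = i ∧ r = s) := fun hh => h ⟨hh.1.symm, hh.2.symm⟩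
    simp only [h, h2, not_false_eq_true, iff_true]
    by_cases h3 : r ∈ T i <;> by_cases h4 : s ∈ T j <;>
      simp only [h3, h4, if_true, if_false, mul_zero, neg_zero]
    rw [sgn_mul_sgn_toggle_mul T h, toggle_comm]

theorem psiStar_psi (i j : Fin N) (r s : ℤ) (V : Fock N S) :
    psiStar i r (psi j s V) = - psi j s (psiStar i r V) + if i = j ∧ s = r then V else 0 := by
  ext T
  by_cases h : i = j ∧ s = r
  · obtain ⟨rfl, rfl⟩ := h
    simp only [Pi.neg_apply, Pi.add_apply, psi_apply, psiStar_apply, mem_toggle, toggle_toggle]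
    by_cases h' : s ∈ T i <;> simp [h', sgn_toggle_self, ← mul_assoc, sgn_mul_self]
  · have h2 : ¬(j = i ∧ r = s) := fun hh => h ⟨hh.1.symm, hh.2.symm⟩
    simp only [Pi.neg_apply, Pi.add_apply, psi_apply, psiStar_apply, mem_toggle, h, h2,
      not_false_eq_true, iff_true, if_false, Pi.zero_apply, add_zero]
    by_cases h3 : r ∈ T i <;> by_cases h4 : s ∈ T j <;>
      simp only [h3, h4, if_true, if_false, mul_zero, neg_zero]
    rw [sgn_mul_sgn_toggle_mul T h, toggle_comm]

end CAR

/-! ### Locally finite sums -/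

theorem finsum_eq_finsum_comp {α β G : Type*} [AddCommMonoid G] {e : α → β}
    (he : Function.Injective e) {f : β → G} (h : Function.support f ⊆ Set.range e) :
    ∑ᶠ b, f b = ∑ᶠ a, f (e a) := by
  rw [← finsum_mem_range he, finsum_mem_def, Set.indicator_eq_self.2 h]

theorem finsum_comm_of_finite {α β G : Type*} [AddCommMonoid G] (f : α → β → G)
    (h : (Function.support fun x : α × β => f x.1 x.2).Finite) :
    ∑ᶠ a, ∑ᶠ b, f a b = ∑ᶠ b, ∑ᶠ a, f a b := by
  have h' : (Function.support fun x : β × α => f x.2 x.1).Finite :=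
    (h.preimage (Prod.swap_injective.injOn)).subset fun x hx => hx
  rw [← finsum_curry (fun x : α × β => f x.1 x.2) h,
    ← finsum_curry (fun x : β × α => f x.2 x.1) h',
    ← finsum_comp_equiv (Equiv.prodComm α β)]
  rfl

section LocallyFinite

variable {N : ℕ} {S : Type*} [CommRing S] {ι κ : Type*}

/-- Only finitely many members of the family contribute to each basis state. -/
def LocallyFin (v : ι → Fock N S) : Prop := ∀ T, (Function.support fun p => v p T).Finite

/-- The sum of a locally finite family of vectors. -/
def lsum (v : ι → Fock N S) : Fock N S := fun T => ∑ᶠ p, v p T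

theorem LocallyFin.smul {v : ι → Fock N S} (hv : LocallyFin v) (c : ι → S) :
    LocallyFin fun p => c p • v p := fun T =>
  (hv T).subset fun p hp hz => hp (by
    have hz : v p T = 0 := hz
    simp [hz])

theorem LocallyFin.psiStar {v : ι → Fock N S} (hv : LocallyFin v) (i : Fin N) (r : ℤ) :
    LocallyFin fun p => psiStar i r (v p) := fun T =>
  (hv (toggle T i r)).subset fun p hp hz => hp (by
    have hz : v p (toggle T i r) = 0 := hz
    simp [psiStar_apply, hz])

theorem LocallyFin.psi {v : ι → Fock N S} (hv : LocallyFin v) (i : Fin N) (r : ℤ) :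
    LocallyFin fun p => psi i r (v p) := fun T =>
  (hv (toggle T i r)).subset fun p hp hz => hp (by
    have hz : v p (toggle T i r) = 0 := hz
    simp [psi_apply, hz])

theorem lsum_smul {v : ι → Fock N S} (hv : LocallyFin v) (c : S) :
    lsum (fun p => c • v p) = c • lsum v := by
  ext T
  simp only [lsum, Pi.smul_apply, smul_eq_mul]
  exact (mul_finsum' _ c (hv T)).symm

theorem lsum_add {v w : ι → Fock N S} (hv : LocallyFin v) (hw : LocallyFin w) :
    lsum (fun p => v p + w p) = lsum v + lsum w := by
  ext T
  exact finsum_add_distrib (hv T) (hw T)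

theorem psiStar_lsum {v : ι → Fock N S} (hv : LocallyFin v) (i : Fin N) (r : ℤ) :
    psiStar i r (lsum v) = lsum fun p => psiStar i r (v p) := by
  ext T
  simp only [lsum, psiStar_apply]
  split_ifs with h
  · simp
  · exact mul_finsum' _ _ (hv _)

theorem psi_lsum {v : ι → Fock N S} (hv : LocallyFin v) (i : Fin N) (r : ℤ) :
    psi i r (lsum v) = lsum fun p => psi i r (v p) := by
  ext T
  simp only [lsum, psi_apply]
  split_ifs with h
  · exact mul_finsum' _ _ (hv _)
  · simp

theorem particles_set_finite (T : States N) :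
    {x : Fin N × ℕ | (x.2 : ℤ) ∈ T x.1}.Finite := by
  have hm : ∀ i, {m : ℕ | (m : ℤ) ∈ T i}.Finite := fun i =>
    Set.Finite.subset ((T i).particles_finite.preimage (f := fun m : ℕ => (m : ℤ))
      (fun _ _ _ _ h => by simpa using h)) fun m hm => ⟨hm, by simp⟩
  exact (Set.finite_univ.prod (Set.finite_iUnion hm)).subset fun x hx =>
    ⟨trivial, Set.mem_iUnion.2 ⟨x.1, hx⟩⟩

theorem holes_set_finite (T : States N) :
    {x : Fin N × ℕ | (-(x.2 : ℤ) - 1) ∉ T x.1}.Finite := by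
  have hn : ∀ j, {n : ℕ | (-(n : ℤ) - 1) ∉ T j}.Finite := fun j =>
    Set.Finite.subset ((T j).holes_finite.preimage (f := fun n : ℕ => (-(n : ℤ) - 1))
      (fun _ _ _ _ h => by simpa using h)) fun n hn => ⟨by
        simp only [Set.mem_Iio]; omega, hn⟩
  exact (Set.finite_univ.prod (Set.finite_iUnion hn)).subset fun x hx =>
    ⟨trivial, Set.mem_iUnion.2 ⟨x.1, hx⟩⟩

theorem quad_set_finite (T : States N) :
    {p : Fin N × Fin N × ℕ × ℕ | (p.2.2.1 : ℤ) ∈ T p.1 ∧ (-(p.2.2.2 : ℤ) - 1) ∉ T p.2.1}.Finite := by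
  refine Set.Finite.subset (((particles_set_finite T).prod (holes_set_finite T)).preimage
    (f := fun p : Fin N × Fin N × ℕ × ℕ => ((p.1, p.2.2.1), (p.2.1, p.2.2.2))) ?_) fun p hp => hp
  rintro ⟨_, _, _, _⟩ - ⟨_, _, _, _⟩ - h
  simp_all

theorem locallyFin_quadTerm (A : Coeffs N S) (V : Fock N S) : LocallyFin (quadTerm A V) :=
  quadTerm_finite A V

theorem locallyFin_psi (V : Fock N S) :
    LocallyFin fun x : Fin N × ℕ => psi x.1 (x.2 : ℤ) V := fun T =>
  (particles_set_finite T).subset fun x hx => by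
    by_contra h
    refine hx ?_
    simp only [psi_apply]
    exact if_neg h

theorem locallyFin_psiStar (V : Fock N S) :
    LocallyFin fun x : Fin N × ℕ => psiStar x.1 (-(x.2 : ℤ) - 1) V := fun T =>
  (holes_set_finite T).subset fun x hx h => hx (by
    simp only [psiStar_apply]
    exact if_pos h)

theorem lsum_comm {v : ι → κ → Fock N S}
    (h : ∀ T, (Function.support fun x : ι × κ => v x.1 x.2 T).Finite) :
    (lsum fun p => lsum (v p)) = lsum fun q => lsum fun p => v p q := by
  ext T
  exact finsum_comm_of_finite (fun p q => v p q T) (h T)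

/-! ### The exponent and locally finite sums -/

theorem quadTerm_lsum (A : Coeffs N S) {v : ι → Fock N S} (hv : LocallyFin v)
    (p : Fin N × Fin N × ℕ × ℕ) : quadTerm A (lsum v) p = lsum fun q => quadTerm A (v q) p := by
  unfold quadTerm
  rw [psiStar_lsum hv, psi_lsum (hv.psiStar _ _), lsum_smul ((hv.psiStar _ _).psi _ _)]

/-- A term contributes at `T` only if its indices pick a particle and a hole of `T`. This bounds `p`
independently of the family `v`. -/
theorem quadTerm_pair_finite (A : Coeffs N S) {v : ι → Fock N S} (hv : LocallyFin v)
    (T : States N) : (Function.support fun x : (Fin N × Fin N × ℕ × ℕ) × ι =>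
      quadTerm A (v x.2) x.1 T).Finite := by
  have hfin : ∀ p, LocallyFin fun q => quadTerm A (v q) p := fun p =>
    ((hv.psiStar _ _).psi _ _).smul fun _ => _
  refine ((quad_set_finite T).biUnion fun p _ =>
    ((hfin p T).image fun q => (p, q))).subset ?_
  rintro ⟨p, q⟩ hx
  obtain ⟨h1, h2, -⟩ := quadTerm_ne_zero hx
  exact Set.mem_iUnion₂.2 ⟨p, ⟨h1, h2⟩, q, hx, rfl⟩

theorem quad_lsum (A : Coeffs N S) {v : ι → Fock N S} (hv : LocallyFin v) :
    quad A (lsum v) = lsum fun q => quad A (v q) := by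
  have h1 : quad A (lsum v) = lsum fun p => lsum fun q => quadTerm A (v q) p := by
    show lsum (quadTerm A (lsum v)) = _
    congr 1
    funext p
    exact quadTerm_lsum A hv p
  rw [h1, lsum_comm (quadTerm_pair_finite A hv)]
  rfl

theorem quad_smul (A : Coeffs N S) (c : S) (V : Fock N S) : quad A (c • V) = c • quad A V := by
  rw [show quad A V = lsum (quadTerm A V) from rfl, ← lsum_smul (locallyFin_quadTerm A V)]
  show lsum (quadTerm A (c • V)) = _
  congr 1
  funext p
  simp only [quadTerm, map_smul, smul_comm c]

theorem quad_zero (A : Coeffs N S) : quad A 0 = 0 := by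
  simpa using quad_smul A 0 0

/-! ### The annihilators of a Bogoliubov transform -/

/-- The operator `∑_{j,n} B^j_n ψ^{j*}_{-(n+1/2)}`. -/
def annih (B : Fin N → ℕ → S) : Fock N S →ₗ[S] Fock N S where
  toFun V := lsum fun x : Fin N × ℕ => B x.1 x.2 • psiStar x.1 (-(x.2 : ℤ) - 1) V
  map_add' V W := by
    rw [← lsum_add ((locallyFin_psiStar V).smul _) ((locallyFin_psiStar W).smul _)]
    simp only [map_add, smul_add]
  map_smul' c V := by
    rw [RingHom.id_apply, ← lsum_smul ((locallyFin_psiStar V).smul _)]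
    simp only [map_smul, smul_comm c]

/-- The operator `∑_{i,m} B^i_m ψ^i_{m+1/2}`. -/
def creat (B : Fin N → ℕ → S) : Fock N S →ₗ[S] Fock N S where
  toFun V := lsum fun x : Fin N × ℕ => B x.1 x.2 • psi x.1 (x.2 : ℤ) V
  map_add' V W := by
    rw [← lsum_add ((locallyFin_psi V).smul _) ((locallyFin_psi W).smul _)]
    simp only [map_add, smul_add]
  map_smul' c V := by
    rw [RingHom.id_apply, ← lsum_smul ((locallyFin_psi V).smul _)]
    simp only [map_smul, smul_comm c]

theorem annih_apply (B : Fin N → ℕ → S) (V : Fock N S) :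
    annih B V = lsum fun x : Fin N × ℕ => B x.1 x.2 • psiStar x.1 (-(x.2 : ℤ) - 1) V := rfl

theorem creat_apply (B : Fin N → ℕ → S) (V : Fock N S) :
    creat B V = lsum fun x : Fin N × ℕ => B x.1 x.2 • psi x.1 (x.2 : ℤ) V := rfl

theorem annih_lsum (B : Fin N → ℕ → S) {v : ι → Fock N S} (hv : LocallyFin v) :
    annih B (lsum v) = lsum fun q => annih B (v q) := by
  have h1 : annih B (lsum v) = lsum fun x : Fin N × ℕ => lsum fun q =>
      B x.1 x.2 • psiStar x.1 (-(x.2 : ℤ) - 1) (v q) := by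
    rw [annih_apply]
    congr 1
    funext x
    rw [psiStar_lsum hv, lsum_smul (hv.psiStar _ _)]
  rw [h1, lsum_comm]
  · rfl
  · intro T
    have hfin : ∀ x : Fin N × ℕ, LocallyFin fun q =>
        B x.1 x.2 • psiStar x.1 (-(x.2 : ℤ) - 1) (v q) := fun x =>
      (hv.psiStar _ _).smul fun _ => _
    refine ((holes_set_finite T).biUnion fun x _ => (hfin x T).image fun q => (x, q)).subset ?_
    rintro ⟨x, q⟩ hx
    refine Set.mem_iUnion₂.2 ⟨x, fun h => hx ?_, q, hx, rfl⟩
    simp [psiStar_apply, h]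

theorem creat_lsum (B : Fin N → ℕ → S) {v : ι → Fock N S} (hv : LocallyFin v) :
    creat B (lsum v) = lsum fun q => creat B (v q) := by
  have h1 : creat B (lsum v) = lsum fun x : Fin N × ℕ => lsum fun q =>
      B x.1 x.2 • psi x.1 (x.2 : ℤ) (v q) := by
    rw [creat_apply]
    congr 1
    funext x
    rw [psi_lsum hv, lsum_smul (hv.psi _ _)]
  rw [h1, lsum_comm]
  · rfl
  · intro T
    have hfin : ∀ x : Fin N × ℕ, LocallyFin fun q =>
        B x.1 x.2 • psi x.1 (x.2 : ℤ) (v q) := fun x =>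
      (hv.psi _ _).smul fun _ => _
    refine ((particles_set_finite T).biUnion fun x _ => (hfin x T).image fun q => (x, q)).subset ?_
    rintro ⟨x, q⟩ hx
    refine Set.mem_iUnion₂.2 ⟨x, ?_, q, hx, rfl⟩
    by_contra h
    refine hx ?_
    have h : (x.2 : ℤ) ∉ T x.1 := h
    simp [psi_apply, h]

/-! ### Commutators of fermions with the exponent -/

theorem psiStar_quadTerm (A : Coeffs N S) (V : Fock N S) (i : Fin N) (r : ℤ)
    (p : Fin N × Fin N × ℕ × ℕ) :
    psiStar i r (quadTerm A V p) = quadTerm A (psiStar i r V) p +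
      (if i = p.1 ∧ (p.2.2.1 : ℤ) = r then A p.1 p.2.1 p.2.2.1 p.2.2.2 else 0) •
        psiStar p.2.1 (-(p.2.2.2 : ℤ) - 1) V := by
  unfold quadTerm
  rw [map_smul, psiStar_psi, psiStar_psiStar i, map_neg, neg_neg, smul_add]
  congr 1
  split_ifs <;> simp

theorem psi_quadTerm (A : Coeffs N S) (V : Fock N S) (i : Fin N) (r : ℤ)
    (p : Fin N × Fin N × ℕ × ℕ) :
    psi i r (quadTerm A V p) = quadTerm A (psi i r V) p +
      (if p.2.1 = i ∧ r = -(p.2.2.2 : ℤ) - 1 then - A p.1 p.2.1 p.2.2.1 p.2.2.2 else 0) •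
        psi p.1 (p.2.2.1 : ℤ) V := by
  unfold quadTerm
  rw [map_smul, psi_psi, psiStar_psi, map_add, smul_add, map_neg, smul_neg]
  split_ifs <;> simp

/-- The creators in the exponent sit at nonnegative positions, so an operator at a negative position
has nothing to contract with. -/
theorem psiStar_quad_hole (A : Coeffs N S) (V : Fock N S) (i : Fin N) (n : ℕ) :
    psiStar i (-(n : ℤ) - 1) (quad A V) = quad A (psiStar i (-(n : ℤ) - 1) V) := by
  show psiStar i (-(n : ℤ) - 1) (lsum (quadTerm A V)) = lsum (quadTerm A _)
  rw [psiStar_lsum (locallyFin_quadTerm A V)]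
  congr 1
  funext p
  rw [psiStar_quadTerm, if_neg (by omega), zero_smul, add_zero]

theorem psi_quad_particle (A : Coeffs N S) (V : Fock N S) (i : Fin N) (m : ℕ) :
    psi i (m : ℤ) (quad A V) = quad A (psi i (m : ℤ) V) := by
  show psi i (m : ℤ) (lsum (quadTerm A V)) = lsum (quadTerm A _)
  rw [psi_lsum (locallyFin_quadTerm A V)]
  congr 1
  funext p
  rw [psi_quadTerm, if_neg (by omega), zero_smul, add_zero]

/-- Contracting with `ψ^i_m` leaves the row `(i, m)` of the coefficients. This commutator commutes
with the exponent by `annih_quad`. -/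
theorem psiStar_quad (A : Coeffs N S) (V : Fock N S) (i : Fin N) (m : ℕ) :
    psiStar i (m : ℤ) (quad A V) =
      quad A (psiStar i (m : ℤ) V) + annih (fun j n => A i j m n) V := by
  have e : Function.Injective fun x : Fin N × ℕ => (i, x.1, m, x.2) := by
    rintro ⟨_, _⟩ ⟨_, _⟩ h
    simp_all
  set w : Fin N × Fin N × ℕ × ℕ → Fock N S := fun p =>
    (if i = p.1 ∧ (p.2.2.1 : ℤ) = m then A p.1 p.2.1 p.2.2.1 p.2.2.2 else 0) •
        psiStar p.2.1 (-(p.2.2.2 : ℤ) - 1) V with hw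
  have hsupp : ∀ T, (Function.support fun p => w p T) ⊆
      Set.range fun x : Fin N × ℕ => (i, x.1, m, x.2) := by
    rintro T ⟨a, b, c, d⟩ hp
    by_cases h : i = a ∧ (c : ℤ) = m
    · obtain ⟨rfl, h⟩ := h
      obtain rfl : c = m := by exact_mod_cast h
      exact ⟨(b, d), rfl⟩
    · refine absurd ?_ hp
      simp only [hw, if_neg h, zero_smul, Pi.zero_apply]
  have hlf : LocallyFin w := by
    intro T
    refine (((locallyFin_psiStar V T).image fun x : Fin N × ℕ => (i, x.1, m, x.2))).subset ?_
    intro p hp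
    obtain ⟨x, rfl⟩ := hsupp T hp
    refine ⟨x, fun hz => hp ?_, rfl⟩
    have hz : psiStar x.1 (-(x.2 : ℤ) - 1) V T = 0 := hz
    simp [hw, hz]
  have h1 : psiStar i (m : ℤ) (quad A V) = lsum fun p => quadTerm A (psiStar i (m : ℤ) V) p + w p := by
    show psiStar i (m : ℤ) (lsum (quadTerm A V)) = _
    rw [psiStar_lsum (locallyFin_quadTerm A V)]
    congr 1
    funext p
    rw [psiStar_quadTerm]
  rw [h1, lsum_add (locallyFin_quadTerm A _) hlf]
  congr 1
  ext T
  refine (finsum_eq_finsum_comp e (hsupp T)).trans ?_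
  simp [hw, annih_apply, lsum]

theorem psi_quad (A : Coeffs N S) (V : Fock N S) (j : Fin N) (n : ℕ) :
    psi j (-(n : ℤ) - 1) (quad A V) =
      quad A (psi j (-(n : ℤ) - 1) V) + creat (fun i m => - A i j m n) V := by
  have e : Function.Injective fun x : Fin N × ℕ => (x.1, j, x.2, n) := by
    rintro ⟨_, _⟩ ⟨_, _⟩ h
    simp_all
  set w : Fin N × Fin N × ℕ × ℕ → Fock N S := fun p =>
    (if p.2.1 = j ∧ -(n : ℤ) - 1 = -(p.2.2.2 : ℤ) - 1 then - A p.1 p.2.1 p.2.2.1 p.2.2.2 else 0) •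
        psi p.1 (p.2.2.1 : ℤ) V with hw
  have hsupp : ∀ T, (Function.support fun p => w p T) ⊆
      Set.range fun x : Fin N × ℕ => (x.1, j, x.2, n) := by
    rintro T ⟨a, b, c, d⟩ hp
    by_cases h : b = j ∧ -(n : ℤ) - 1 = -(d : ℤ) - 1
    · obtain ⟨rfl, h⟩ := h
      obtain rfl : d = n := by omega
      exact ⟨(a, c), rfl⟩
    · refine absurd ?_ hp
      simp only [hw, if_neg h, zero_smul, Pi.zero_apply]
  have hlf : LocallyFin w := by
    intro T
    refine (((locallyFin_psi V T).image fun x : Fin N × ℕ => (x.1, j, x.2, n))).subset ?_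
    intro p hp
    obtain ⟨x, rfl⟩ := hsupp T hp
    refine ⟨x, fun hz => hp ?_, rfl⟩
    have hz : psi x.1 (x.2 : ℤ) V T = 0 := hz
    simp [hw, hz]
  have h1 : psi j (-(n : ℤ) - 1) (quad A V) =
      lsum fun p => quadTerm A (psi j (-(n : ℤ) - 1) V) p + w p := by
    show psi j (-(n : ℤ) - 1) (lsum (quadTerm A V)) = _
    rw [psi_lsum (locallyFin_quadTerm A V)]
    congr 1
    funext p
    rw [psi_quadTerm]
  rw [h1, lsum_add (locallyFin_quadTerm A _) hlf]
  congr 1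
  ext T
  refine (finsum_eq_finsum_comp e (hsupp T)).trans ?_
  simp [hw, creat_apply, lsum]

theorem annih_quad (A : Coeffs N S) (B : Fin N → ℕ → S) (V : Fock N S) :
    annih B (quad A V) = quad A (annih B V) := by
  rw [annih_apply, annih_apply, quad_lsum A ((locallyFin_psiStar V).smul _)]
  congr 1
  funext x
  rw [psiStar_quad_hole, quad_smul]

theorem creat_quad (A : Coeffs N S) (B : Fin N → ℕ → S) (V : Fock N S) :
    creat B (quad A V) = quad A (creat B V) := by
  rw [creat_apply, creat_apply, quad_lsum A ((locallyFin_psi V).smul _)]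
  congr 1
  funext x
  rw [psi_quad_particle, quad_smul]

theorem psiStar_vac (i : Fin N) (m : ℕ) : psiStar i (m : ℤ) (vac : Fock N S) = 0 := by
  ext T
  rw [psiStar_apply]
  split_ifs with h
  · rfl
  · rw [vac, Pi.single_eq_of_ne, mul_zero, Pi.zero_apply]
    intro h'
    have : (m : ℤ) ∈ toggle T i m i := mem_toggle.2 (by simp [h])
    rw [h', mem_vacuum] at this
    omega

theorem psi_vac (j : Fin N) (n : ℕ) : psi j (-(n : ℤ) - 1) (vac : Fock N S) = 0 := by
  ext T
  rw [psi_apply]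
  split_ifs with h
  · rw [vac, Pi.single_eq_of_ne, mul_zero, Pi.zero_apply]
    intro h'
    have : (-(n : ℤ) - 1) ∉ toggle T j (-(n : ℤ) - 1) j := by
      rw [mem_toggle]
      simp [h]
    rw [h', mem_vacuum] at this
    omega
  · rfl

variable [Algebra ℂ S]

theorem bogoliubov_eq_lsum (A : Coeffs N S) :
    bogoliubov A = lsum fun k : ℕ => ((k ! : ℂ)⁻¹) • (quad A)^[k] vac := rfl

theorem locallyFin_bogoliubov (A : Coeffs N S) :
    LocallyFin fun k : ℕ => ((k ! : ℂ)⁻¹) • (quad A)^[k] (vac : Fock N S) :=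
  quad_iterate_vac_finite A

/-- If the commutator of `D` with the exponent is `C`, which commutes with the exponent, and `D`
kills the vacuum, then `D - C` kills the Bogoliubov transform. -/
theorem map_bogoliubov (A : Coeffs N S) (D C : Fock N S →ₗ[S] Fock N S)
    (hD : ∀ v : ℕ → Fock N S, LocallyFin v → D (lsum v) = lsum fun k => D (v k))
    (hC : ∀ v : ℕ → Fock N S, LocallyFin v → C (lsum v) = lsum fun k => C (v k))
    (hDquad : ∀ V, D (quad A V) = quad A (D V) + C V)
    (hCquad : ∀ V, C (quad A V) = quad A (C V)) (hvac : D vac = 0) :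
    D (bogoliubov A) = C (bogoliubov A) := by
  -- As `C` is central relative to the exponent, each of the `k + 1` factors contributes the same
  -- term; the factor `k + 1` cancels against the factorial.
  have hiter : ∀ k : ℕ, D ((quad A)^[k + 1] vac) = ((k : S) + 1) • C ((quad A)^[k] vac) := by
    intro k
    induction k with
    | zero => simp [hDquad, hvac, quad_zero]
    | succ k ih =>
      rw [Function.iterate_succ_apply', hDquad, ih, quad_smul, ← hCquad,
        ← Function.iterate_succ_apply' (quad A) k]
      push_cast
      rw [add_smul ((k : S) + 1), one_smul]
  rw [bogoliubov_eq_lsum, hD _ (locallyFin_bogoliubov A), hC _ (locallyFin_bogoliubov A)]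
  ext T
  -- Term `k + 1` on the left matches term `k` on the right; term `0` vanishes because `D` kills the
  -- vacuum.
  refine (finsum_eq_finsum_comp (e := fun k : ℕ => k + 1) (add_left_injective 1) ?_).trans ?_
  · rintro (_ | k) hk
    · simp [hvac] at hk
    · exact ⟨k, rfl⟩
  · refine finsum_congr fun k => ?_
    have hk : ((k : S) + 1) = algebraMap ℂ S (k + 1) := by simp
    simp only [LinearMap.map_smul_of_tower]
    rw [hiter, hk, algebraMap_smul,
      smul_smul]
    have hk1 : ((k : ℂ) + 1) ≠ 0 := by exact_mod_cast k.succ_ne_zero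
    rw [Nat.factorial_succ]
    push_cast
    field_simp

theorem psiStar_bogoliubov (A : Coeffs N S) (i : Fin N) (m : ℕ) :
    psiStar i (m : ℤ) (bogoliubov A) = annih (fun j n => A i j m n) (bogoliubov A) :=
  map_bogoliubov A _ _ (fun _ hv => psiStar_lsum hv _ _) (fun _ hv => annih_lsum _ hv)
    (fun V => psiStar_quad A V i m) (fun V => annih_quad A _ V) (psiStar_vac i m)

/-- The dual relations, applied to the gluing vector once `ψ^*` has been moved across the pairing;
they also bound its coefficients at states with deep holes. -/
theorem psi_bogoliubov (A : Coeffs N S) (j : Fin N) (n : ℕ) :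
    psi j (-(n : ℤ) - 1) (bogoliubov A) = creat (fun i m => - A i j m n) (bogoliubov A) :=
  map_bogoliubov A _ _ (fun _ hv => psi_lsum hv _ _) (fun _ hv => creat_lsum _ hv)
    (fun V => psi_quad A V j n) (fun V => creat_quad A _ V) (psi_vac j n)

end LocallyFinite

/-! ### Characterization of Bogoliubov transforms by their annihilators -/

section Uniqueness

variable {N : ℕ} {S : Type*} [CommRing S]

/-- Each term of the exponent makes one particle and one hole, possibly in different components, so
only the total charge is preserved. -/
theorem quad_iterate_vac_charge (A : Coeffs N S) (k : ℕ) :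
    ∀ T : States N, (quad A)^[k] vac T ≠ 0 → ∑ i, (T i).charge = 0 := by
  induction k with
  | zero =>
    intro T hT
    have : T = fun _ => Maya.vacuum := by
      by_contra hne
      exact hT (Pi.single_eq_of_ne hne _)
    subst this
    simp [Maya.charge, Maya.vacuum]
  | succ k ih =>
    intro T hT
    rw [Function.iterate_succ_apply'] at hT
    obtain ⟨⟨i, j, m, n⟩, hp⟩ : ∃ p, quadTerm A ((quad A)^[k] vac) p T ≠ 0 := by
      by_contra! h
      exact hT (by simp [quad, h])
    obtain ⟨h1, h2, h3⟩ := quadTerm_ne_zero hp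
    have h4 := ih _ h3
    have h5 : (-(n : ℤ) - 1) ∉ remove T i m j := fun h => h2 (mem_remove.1 h).2
    simp only [charge_add h5, Finset.sum_add_distrib] at h4
    have h6 : ∑ l, (T l).charge = ∑ l, (add (remove T i m) i m l).charge := by
      rw [add_remove T i m h1]
    simp only [charge_add (notMem_remove_self T i m), Finset.sum_add_distrib] at h6
    simp only [Finset.sum_ite_eq, Finset.mem_univ, if_true] at h4 h6
    rw [h6, h4]

theorem exists_mem_of_particles_ne_zero {T : States N} (h : particles T ≠ 0) :
    ∃ (i : Fin N) (m : ℕ), (m : ℤ) ∈ T i := by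
  obtain ⟨i, -, hi⟩ := Finset.exists_ne_zero_of_sum_ne_zero h
  obtain ⟨r, hr, hr'⟩ := Set.nonempty_of_ncard_ne_zero hi
  have hr0 : 0 ≤ r := not_lt.1 hr'
  lift r to ℕ using hr0
  exact ⟨i, r, hr⟩

/-- Induction on the number of particles: the relation for a particle `(i, m)` of `T`, read at `T`
with it removed, gives the coefficient at `T` in terms of states where that particle is traded for a
hole. -/
theorem eq_zero_of_annih (A : Coeffs N S) (W : Fock N S)
    (h1 : ∀ i (m : ℕ), psiStar i (m : ℤ) W = annih (fun j n => A i j m n) W)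
    (h2 : ∀ T, particles T = 0 → W T = 0) : W = 0 := by
  have key : ∀ k T, particles T = k → W T = 0 := by
    intro k
    induction k with
    | zero => exact h2
    | succ k ih =>
      intro T hT
      obtain ⟨i, m, hm⟩ := exists_mem_of_particles_ne_zero (T := T) (by omega)
      have h3 := congrFun (h1 i m) (remove T i m)
      have h4 : annih (fun j n => A i j m n) W (remove T i m) = 0 := by
        refine finsum_eq_zero_of_forall_eq_zero fun x => ?_
        show A i x.1 m x.2 * psiStar x.1 (-(x.2 : ℤ) - 1) W (remove T i m) = 0
        rw [psiStar_apply]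
        split_ifs with hx
        · simp
        -- Filling a position in the negative range instead leaves one particle fewer than in `T`.
        · rw [toggle, if_neg hx, ih _ (by have := particles_quad T i x.1 m x.2 hm; omega)]
          simp
      rw [h4, psiStar_apply, if_neg (notMem_remove_self T i m), toggle,
        if_neg (notMem_remove_self T i m), add_remove T i m hm] at h3
      have h5 := congrArg (fun z => ((sgn (remove T i m) i m : ℤ) : S) * z) h3
      simpa [← mul_assoc, sgn_mul_self] using h5
  ext T
  exact key _ T rfl

variable [Algebra ℂ S]

theorem bogoliubov_apply (A : Coeffs N S) (T : States N) :
    bogoliubov A T = (((particles T)! : ℂ)⁻¹) • ((quad A)^[particles T] vac T) := by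
  refine finsum_eq_single _ _ fun k hk => ?_
  by_contra h
  refine hk (quad_iterate_vac_ne_zero A k T fun h' => h ?_).symm
  rw [h', smul_zero]

theorem particles_vacuum : particles (fun _ : Fin N => Maya.vacuum) = 0 := by
  simp [particles, Maya.vacuum]

theorem bogoliubov_vacuum (A : Coeffs N S) : bogoliubov A (fun _ => Maya.vacuum) = 1 := by
  rw [bogoliubov_apply, particles_vacuum]
  simp [vac]

theorem bogoliubov_eq_zero_of_particles (A : Coeffs N S) {T : States N} (h : particles T = 0)
    (hT : T ≠ fun _ => Maya.vacuum) : bogoliubov A T = 0 := by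
  rw [bogoliubov_apply, h, Function.iterate_zero, id, vac, Pi.single_eq_of_ne hT, smul_zero]

theorem charge_of_bogoliubov_ne_zero {A : Coeffs N S} {T : States N} (h : bogoliubov A T ≠ 0) :
    ∑ i, (T i).charge = 0 := by
  refine quad_iterate_vac_charge A (particles T) T fun h' => h ?_
  rw [bogoliubov_apply, h', smul_zero]

/-- The difference of the two sides satisfies the same linear relations and vanishes at all
particle-free states, so `eq_zero_of_annih` applies. -/
theorem eq_smul_bogoliubov (A : Coeffs N S) (W : Fock N S)
    (h1 : ∀ i (m : ℕ), psiStar i (m : ℤ) W = annih (fun j n => A i j m n) W)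
    (h2 : ∀ T, T ≠ (fun _ => Maya.vacuum) → particles T = 0 → W T = 0) :
    W = W (fun _ => Maya.vacuum) • bogoliubov A := by
  rw [← sub_eq_zero]
  refine eq_zero_of_annih A _ (fun i m => ?_) fun T hT => ?_
  · rw [map_sub, map_sub, map_smul, map_smul, h1, psiStar_bogoliubov]
  · by_cases hv : T = fun _ => Maya.vacuum
    · subst hv
      simp [bogoliubov_vacuum]
    · simp [h2 T hv hT, bogoliubov_eq_zero_of_particles A hT hv]

/-- A neutral state without particles is the vacuum. -/
theorem eq_vacuum_of_neutral {T : States N} (h : particles T = 0) (hc : ∑ i, (T i).charge = 0) :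
    T = fun _ => Maya.vacuum := by
  have hp : ∀ i, ((T i).carrier \ Set.Iio 0).ncard = 0 := fun i =>
    Finset.sum_eq_zero_iff.1 h i (Finset.mem_univ i)
  have hh : ∑ i, (Set.Iio 0 \ (T i).carrier).ncard = 0 := by
    have : ∑ i, (T i).charge = -((∑ i, (Set.Iio 0 \ (T i).carrier).ncard : ℕ) : ℤ) := by
      simp [Maya.charge, hp]
    omega
  refine States.ext fun i r => ?_
  rw [mem_vacuum]
  have h1 := (Set.ncard_eq_zero (T i).particles_finite).1 (hp i)
  have h2 := (Set.ncard_eq_zero (T i).holes_finite).1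
    (Finset.sum_eq_zero_iff.1 hh i (Finset.mem_univ i))
  exact ⟨fun hr => by_contra fun hn => (h1.subset ⟨hr, hn⟩ : r ∈ (∅ : Set ℤ)),
    fun hr => by_contra fun hn => (h2.subset ⟨hr, hn⟩ : r ∈ (∅ : Set ℤ))⟩

end Uniqueness

/-! ### Tensor products of Bogoliubov transforms -/

section Tensor

variable {M N : ℕ}

/-- The position of the components of `F₁ ⊗ ⋯ ⊗ F_M ⊗ F_a` in
`F₁ ⊗ ⋯ ⊗ F_{M+N} ⊗ F_a ⊗ F_b`. -/
def leftPos (M N : ℕ) : Fin (M + 1) → Fin (M + N + 2) :=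
  Fin.snoc (α := fun _ => Fin (M + N + 2)) (fun i => Fin.castAdd 2 (Fin.castAdd N i))
    (Fin.natAdd (M + N) 0)

/-- The position of the components of `F_{M+1} ⊗ ⋯ ⊗ F_{M+N} ⊗ F_b` in
`F₁ ⊗ ⋯ ⊗ F_{M+N} ⊗ F_a ⊗ F_b`. -/
def rightPos (M N : ℕ) : Fin (N + 1) → Fin (M + N + 2) :=
  Fin.snoc (α := fun _ => Fin (M + N + 2)) (fun j => Fin.castAdd 2 (Fin.natAdd M j))
    (Fin.natAdd (M + N) 1)

@[simp] theorem leftPos_castSucc (i : Fin M) :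
    leftPos M N i.castSucc = Fin.castAdd 2 (Fin.castAdd N i) := by simp [leftPos]

@[simp] theorem leftPos_last : leftPos M N (Fin.last M) = Fin.natAdd (M + N) 0 := by
  simp [leftPos]

@[simp] theorem rightPos_castSucc (j : Fin N) :
    rightPos M N j.castSucc = Fin.castAdd 2 (Fin.natAdd M j) := by simp [rightPos]

@[simp] theorem rightPos_last : rightPos M N (Fin.last N) = Fin.natAdd (M + N) 1 := by
  simp [rightPos]

theorem side_leftPos (i : Fin (M + 1)) : side (leftPos M N i) = Sum.inl i := by
  induction i using Fin.lastCases with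
  | last => rw [leftPos_last, side, Fin.append_right]; rfl
  | cast i => rw [leftPos_castSucc, side, Fin.append_left, Fin.append_left]

theorem side_rightPos (j : Fin (N + 1)) : side (rightPos M N j) = Sum.inr j := by
  induction j using Fin.lastCases with
  | last => rw [rightPos_last, side, Fin.append_right]; rfl
  | cast j => rw [rightPos_castSucc, side, Fin.append_left, Fin.append_right]

theorem leftPos_injective : Function.Injective (leftPos M N) := fun i j h => by
  simpa [side_leftPos] using congrArg side h

theorem rightPos_injective : Function.Injective (rightPos M N) := fun i j h => by
  simpa [side_rightPos] using congrArg side h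

theorem leftPos_ne_rightPos (i : Fin (M + 1)) (j : Fin (N + 1)) :
    leftPos M N i ≠ rightPos M N j := fun h => by
  simpa [side_rightPos, side_leftPos] using congrArg side h

theorem exists_pos (i : Fin (M + N + 2)) :
    (∃ i', i = leftPos M N i') ∨ ∃ j', i = rightPos M N j' := by
  induction i using Fin.addCases with
  | left i =>
    induction i using Fin.addCases with
    | left i => exact Or.inl ⟨i.castSucc, by simp⟩
    | right i => exact Or.inr ⟨i.castSucc, by simp⟩
  | right i =>
    fin_cases i
    · exact Or.inl ⟨Fin.last M, leftPos_last.symm⟩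
    · exact Or.inr ⟨Fin.last N, rightPos_last.symm⟩

theorem sum_pos {G : Type*} [AddCommMonoid G] (F : Fin (M + N + 2) → G) :
    ∑ i, F i = ∑ i, F (leftPos M N i) + ∑ j, F (rightPos M N j) := by
  rw [Fin.sum_univ_add, Fin.sum_univ_add, Fin.sum_univ_two, Fin.sum_univ_castSucc,
    Fin.sum_univ_castSucc]
  simp only [leftPos_castSucc, leftPos_last, rightPos_castSucc, rightPos_last]
  abel

/-- Only `a`, the last component of the left factor, comes after components of the right one: all of
them except `b`. -/
theorem sum_Iio_leftPos (c : Fin (M + N + 2) → ℤ) (i : Fin (M + 1)) :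
    ∑ j ∈ Finset.Iio (leftPos M N i), c j = ∑ j ∈ Finset.Iio i, c (leftPos M N j) +
      if i = Fin.last M then ∑ j : Fin N, c (rightPos M N j.castSucc) else 0 := by
  rw [Iio_eq_filter_univ, Iio_eq_filter_univ, Finset.sum_filter, Finset.sum_filter,
    sum_pos, Fin.sum_univ_castSucc (n := N)]
  induction i using Fin.lastCases with
  | last =>
    rw [if_pos rfl, if_neg (by rw [Fin.lt_def]; simp), add_zero]
    congr 1
    · refine Finset.sum_congr rfl fun j _ => ?_
      congr 1
      rw [eq_iff_iff, Fin.lt_def, Fin.lt_def]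
      induction j using Fin.lastCases <;> simp
      omega
    · refine Finset.sum_congr rfl fun j _ => if_pos ?_
      rw [Fin.lt_def]
      simp
  | cast i =>
    rw [if_neg (Fin.castSucc_ne_last i), if_neg (by rw [Fin.lt_def]; simp; omega), add_zero, add_zero,
      Finset.sum_eq_zero (s := (Finset.univ : Finset (Fin N))), add_zero]
    · refine Finset.sum_congr rfl fun j _ => ?_
      congr 1
      rw [eq_iff_iff, Fin.lt_def, Fin.lt_def]
      induction j using Fin.lastCases <;> simp
      omega
    · refine fun j _ => if_neg ?_
      rw [Fin.lt_def]
      simp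
      omega

theorem sum_Iio_rightPos (c : Fin (M + N + 2) → ℤ) (i : Fin (N + 1)) :
    ∑ j ∈ Finset.Iio (rightPos M N i), c j = ∑ j ∈ Finset.Iio i, c (rightPos M N j) +
      ∑ j : Fin M, c (leftPos M N j.castSucc) +
      if i = Fin.last N then c (leftPos M N (Fin.last M)) else 0 := by
  rw [Iio_eq_filter_univ, Iio_eq_filter_univ, Finset.sum_filter, Finset.sum_filter,
    sum_pos, Fin.sum_univ_castSucc (n := M)]
  refine (add_comm _ _).trans (Eq.trans ?_ (add_assoc _ _ _).symm)
  congr 1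
  · refine Finset.sum_congr rfl fun j _ => ?_
    congr 1
    rw [eq_iff_iff, Fin.lt_def, Fin.lt_def]
    induction j using Fin.lastCases <;> induction i using Fin.lastCases <;> simp
    omega
  · congr 1
    · refine Finset.sum_congr rfl fun j _ => if_pos ?_
      rw [Fin.lt_def]
      induction i using Fin.lastCases <;> simp <;> omega
    · congr 1
      rw [eq_iff_iff, Fin.lt_def]
      induction i using Fin.lastCases <;> simp

/-- The Koszul sign of the tensor product. -/
def tensorSign (T : States (M + N + 2)) : ℤˣ :=
  Int.negOnePow ((T (leftPos M N (Fin.last M))).charge *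
    ∑ j : Fin N, (T (rightPos M N j.castSucc)).charge)

variable {R : Type*} [CommRing R]

theorem tensor_apply (V₁ : Fock (M + 1) (GlueRing R)) (V₂ : Fock (N + 1) (GlueRing R))
    (T : States (M + N + 2)) : tensor V₁ V₂ T =
      ((tensorSign T : ℤ) : GlueRing R) * (V₁ (T ∘ leftPos M N) * V₂ (T ∘ rightPos M N)) := by
  have h1 : T ∘ leftPos M N = Fin.snoc (α := fun _ => Maya)
      (fun i : Fin M => T (Fin.castAdd 2 (Fin.castAdd N i))) (T (Fin.natAdd (M + N) 0)) := by
    funext i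
    induction i using Fin.lastCases <;> simp
  have h2 : T ∘ rightPos M N = Fin.snoc (α := fun _ => Maya)
      (fun j : Fin N => T (Fin.castAdd 2 (Fin.natAdd M j))) (T (Fin.natAdd (M + N) 1)) := by
    funext i
    induction i using Fin.lastCases <;> simp
  rw [h1, h2, tensorSign]
  simp only [leftPos_last, rightPos_castSucc]
  rfl

theorem add_comp_of_injective {K L : ℕ} {e : Fin K → Fin L} (he : Function.Injective e)
    (T : States L) (i : Fin K) (r : ℤ) : add T (e i) r ∘ e = add (T ∘ e) i r :=
  States.ext fun j s => by
    show s ∈ add T (e i) r (e j) ↔ _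
    rw [mem_add, mem_add, he.eq_iff]
    rfl

theorem add_comp_of_ne {K L : ℕ} {e : Fin K → Fin L} (T : States L) {i : Fin L}
    (h : ∀ j, i ≠ e j) (r : ℤ) : add T i r ∘ e = T ∘ e :=
  States.ext fun j s => by
    show s ∈ add T i r (e j) ↔ s ∈ T (e j)
    rw [mem_add]
    simp [h j]

/-- For `a`, the sign of passing the external components of the right factor cancels against the
change of the Koszul sign when the charge of `a` grows by one. -/
theorem sgn_mul_tensorSign_leftPos (T : States (M + N + 2)) (i : Fin (M + 1)) (r : ℤ)
    (h : r ∉ T (leftPos M N i)) :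
    sgn T (leftPos M N i) r * tensorSign (add T (leftPos M N i) r) =
      tensorSign T * sgn (T ∘ leftPos M N) i r := by
  simp only [sgn, tensorSign, charge_add h, sum_Iio_leftPos, leftPos_ne_rightPos, if_false,
    add_zero, leftPos_injective.eq_iff, Function.comp_apply]
  rw [← Int.negOnePow_add, ← Int.negOnePow_add, Int.negOnePow_eq_iff]
  split_ifs with hi
  · exact ⟨∑ j : Fin N, (T (rightPos M N j.castSucc)).charge, by ring⟩
  · exact ⟨0, by ring⟩

/-- The leftover sign is that of passing the whole left factor. It does not depend on `i` or `r`, so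
it drops out of linear relations between operators on the right factor. -/
theorem sgn_mul_tensorSign_rightPos (T : States (M + N + 2)) (i : Fin (N + 1)) (r : ℤ)
    (h : r ∉ T (rightPos M N i)) :
    sgn T (rightPos M N i) r * tensorSign (add T (rightPos M N i) r) =
      Int.negOnePow (∑ j, (T (leftPos M N j)).charge) *
        (tensorSign T * sgn (T ∘ rightPos M N) i r) := by
  simp only [sgn, tensorSign, charge_add h, sum_Iio_rightPos, (leftPos_ne_rightPos _ _).symm,
    if_false, add_zero, rightPos_injective.eq_iff, Function.comp_apply, Finset.sum_add_distrib,
    Fin.sum_univ_castSucc (n := M)]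
  rw [← Int.negOnePow_add, ← Int.negOnePow_add, ← Int.negOnePow_add, Int.negOnePow_eq_iff]
  induction i using Fin.lastCases with
  | last =>
    have : ∀ x : Fin N, (Fin.last N = x.castSucc) = False := fun x =>
      eq_false (Fin.castSucc_ne_last x).symm
    simp only [this, if_true, if_false, Finset.sum_const_zero]
    exact ⟨0, by ring⟩
  | cast i =>
    simp only [Fin.castSucc_ne_last, if_false, Fin.castSucc_inj, Finset.sum_ite_eq,
      Finset.mem_univ, if_true]
    exact ⟨0, by ring⟩

theorem psiStar_tensor_left (V₁ : Fock (M + 1) (GlueRing R)) (V₂ : Fock (N + 1) (GlueRing R))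
    (i : Fin (M + 1)) (r : ℤ) (T : States (M + N + 2)) :
    psiStar (leftPos M N i) r (tensor V₁ V₂) T = ((tensorSign T : ℤ) : GlueRing R) *
      (psiStar i r V₁ (T ∘ leftPos M N) * V₂ (T ∘ rightPos M N)) := by
  show (if r ∈ T (leftPos M N i) then 0 else _) =
    _ * ((if r ∈ T (leftPos M N i) then 0 else _) * _)
  split_ifs with h
  · simp
  · have hs := congrArg (fun u : ℤˣ => ((u : ℤ) : GlueRing R)) (sgn_mul_tensorSign_leftPos T i r h)
    simp only [Units.val_mul, Int.cast_mul] at hs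
    rw [tensor_apply, add_comp_of_injective leftPos_injective,
      add_comp_of_ne T (leftPos_ne_rightPos i), ← mul_assoc, hs]
    ring

theorem psiStar_tensor_right (V₁ : Fock (M + 1) (GlueRing R)) (V₂ : Fock (N + 1) (GlueRing R))
    (i : Fin (N + 1)) (r : ℤ) (T : States (M + N + 2)) :
    psiStar (rightPos M N i) r (tensor V₁ V₂) T =
      ((Int.negOnePow (∑ j, (T (leftPos M N j)).charge) : ℤ) : GlueRing R) *
        ((tensorSign T : ℤ) : GlueRing R) *
      (V₁ (T ∘ leftPos M N) * psiStar i r V₂ (T ∘ rightPos M N)) := by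
  show (if r ∈ T (rightPos M N i) then 0 else _) =
    _ * (_ * (if r ∈ T (rightPos M N i) then 0 else _))
  split_ifs with h
  · simp
  · have hs := congrArg (fun u : ℤˣ => ((u : ℤ) : GlueRing R)) (sgn_mul_tensorSign_rightPos T i r h)
    simp only [Units.val_mul, Int.cast_mul] at hs
    rw [tensor_apply, add_comp_of_injective rightPos_injective,
      add_comp_of_ne T fun j => (leftPos_ne_rightPos j i).symm, ← mul_assoc, hs]
    ring

theorem psiStar_tensor (A₁ : Coeffs (M + 1) (GlueRing R)) (A₂ : Coeffs (N + 1) (GlueRing R))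
    {V₁ : Fock (M + 1) (GlueRing R)} {V₂ : Fock (N + 1) (GlueRing R)}
    (h₁ : ∀ i (m : ℕ), psiStar i (m : ℤ) V₁ = annih (fun j n => A₁ i j m n) V₁)
    (h₂ : ∀ i (m : ℕ), psiStar i (m : ℤ) V₂ = annih (fun j n => A₂ i j m n) V₂)
    (i : Fin (M + N + 2)) (m : ℕ) :
    psiStar i (m : ℤ) (tensor V₁ V₂) =
      annih (fun j n => blockCoeffs A₁ A₂ i j m n) (tensor V₁ V₂) := by
  funext T
  rw [annih_apply]
  obtain ⟨i, rfl⟩ | ⟨i, rfl⟩ := exists_pos i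
  · have e : Function.Injective fun x : Fin (M + 1) × ℕ => (leftPos M N x.1, x.2) := by
      rintro ⟨_, _⟩ ⟨_, _⟩ h
      simpa [leftPos_injective.eq_iff] using h
    refine Eq.trans ?_ (finsum_eq_finsum_comp e ?_).symm
    · rw [psiStar_tensor_left, h₁, annih_apply, lsum, finsum_mul' _ _
        ((locallyFin_psiStar V₁).smul _ _), mul_finsum' _ _ ?_]
      · refine finsum_congr fun x => ?_
        simp only [Pi.smul_apply, psiStar_tensor_left, blockCoeffs, side_leftPos, smul_eq_mul]
        ring
      · refine ((locallyFin_psiStar V₁).smul (fun x => A₁ i x.1 m x.2) (T ∘ leftPos M N)).subset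
          fun x hx hz => hx ?_
        have hz : (A₁ i x.1 m x.2 • psiStar x.1 (-(x.2 : ℤ) - 1) V₁) (T ∘ leftPos M N) = 0 := hz
        simp only [hz, zero_mul]
    · rintro ⟨j, n⟩ hx
      obtain ⟨j, rfl⟩ | ⟨j, rfl⟩ := exists_pos j
      · exact ⟨(j, n), rfl⟩
      · simp [blockCoeffs, side_leftPos, side_rightPos] at hx
  · have e : Function.Injective fun x : Fin (N + 1) × ℕ => (rightPos M N x.1, x.2) := by
      rintro ⟨_, _⟩ ⟨_, _⟩ h
      simpa [rightPos_injective.eq_iff] using h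
    refine Eq.trans ?_ (finsum_eq_finsum_comp e ?_).symm
    · rw [psiStar_tensor_right, h₂, annih_apply, lsum, mul_finsum' _ _
        ((locallyFin_psiStar V₂).smul _ _), mul_finsum' _ _ ?_]
      · refine finsum_congr fun x => ?_
        simp only [Pi.smul_apply, psiStar_tensor_right, blockCoeffs, side_rightPos, smul_eq_mul]
        ring
      · refine ((locallyFin_psiStar V₂).smul (fun x => A₂ i x.1 m x.2) (T ∘ rightPos M N)).subset
          fun x hx hz => hx ?_
        have hz : (A₂ i x.1 m x.2 • psiStar x.1 (-(x.2 : ℤ) - 1) V₂) (T ∘ rightPos M N) = 0 := hz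
        simp only [hz, mul_zero]
    · rintro ⟨j, n⟩ hx
      obtain ⟨j, rfl⟩ | ⟨j, rfl⟩ := exists_pos j
      · simp [blockCoeffs, side_leftPos, side_rightPos] at hx
      · exact ⟨(j, n), rfl⟩

theorem particles_comp_eq_zero {K L : ℕ} (e : Fin K → Fin L) {T : States L}
    (h : particles T = 0) : particles (T ∘ e) = 0 :=
  Finset.sum_eq_zero fun i _ => Finset.sum_eq_zero_iff.1 h (e i) (Finset.mem_univ _)

theorem tensor_bogoliubov [Algebra ℂ R] (A₁ : Coeffs (M + 1) (GlueRing R))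
    (A₂ : Coeffs (N + 1) (GlueRing R)) :
    tensor (bogoliubov A₁) (bogoliubov A₂) = bogoliubov (blockCoeffs A₁ A₂) := by
  rw [eq_smul_bogoliubov (blockCoeffs A₁ A₂) (tensor (bogoliubov A₁) (bogoliubov A₂))
    (psiStar_tensor A₁ A₂ (psiStar_bogoliubov A₁) (psiStar_bogoliubov A₂))]
  · have h1 : bogoliubov A₁ ((fun _ => Maya.vacuum) ∘ leftPos M N) = 1 := bogoliubov_vacuum A₁
    have h2 : bogoliubov A₂ ((fun _ => Maya.vacuum) ∘ rightPos M N) = 1 := bogoliubov_vacuum A₂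
    rw [tensor_apply, h1, h2]
    simp [tensorSign, Maya.charge, Maya.vacuum]
  · intro T hT hp
    rw [tensor_apply]
    by_cases h1 : T ∘ leftPos M N = fun _ => Maya.vacuum
    · by_cases h2 : T ∘ rightPos M N = fun _ => Maya.vacuum
      · refine absurd (funext fun i => ?_) hT
        obtain ⟨i, rfl⟩ | ⟨i, rfl⟩ := exists_pos i
        · exact congrFun h1 i
        · exact congrFun h2 i
      · rw [bogoliubov_eq_zero_of_particles A₂ (particles_comp_eq_zero _ hp) h2]
        simp
    · rw [bogoliubov_eq_zero_of_particles A₁ (particles_comp_eq_zero _ hp) h1]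
      simp

end Tensor

/-! ### Adically convergent sums of power series -/

section AdicSum

variable {B : Type*} [CommRing B] {ι κ : Type*}

/-- The sum of a family of power series, computed separately in each degree. -/
def adicSum (g : ι → B⟦X⟧) : B⟦X⟧ := PowerSeries.mk fun k => ∑ᶠ i, PowerSeries.coeff k (g i)

/-- The family tends to zero `X`-adically. -/
def AdicSummable (g : ι → B⟦X⟧) : Prop := ∀ k, {i | ¬ PowerSeries.X ^ k ∣ g i}.Finite

theorem coeff_adicSum (g : ι → B⟦X⟧) (k : ℕ) :
    PowerSeries.coeff k (adicSum g) = ∑ᶠ i, PowerSeries.coeff k (g i) :=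
  PowerSeries.coeff_mk _ _

theorem AdicSummable.coeff_finite {g : ι → B⟦X⟧} (hg : AdicSummable g) (k : ℕ) :
    (Function.support fun i => PowerSeries.coeff k (g i)).Finite :=
  (hg (k + 1)).subset fun _ hi hd => hi (PowerSeries.X_pow_dvd_iff.1 hd k k.lt_succ_self)

theorem AdicSummable.mono {g h : ι → B⟦X⟧} (hg : AdicSummable g) (hd : ∀ i, g i ∣ h i) :
    AdicSummable h := fun k =>
  (hg k).subset fun i hi hk => hi (hk.trans (hd i))

theorem AdicSummable.mul_left {g : ι → B⟦X⟧} (hg : AdicSummable g) (c : ι → B⟦X⟧) :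
    AdicSummable fun i => c i * g i :=
  hg.mono fun _ => Dvd.intro_left _ rfl

theorem adicSummable_of_finite {g : ι → B⟦X⟧} (hg : (Function.support g).Finite) :
    AdicSummable g := fun _ =>
  hg.subset fun i hi h0 => hi (by rw [h0]; exact dvd_zero _)

theorem AdicSummable.comp_injective {g : ι → B⟦X⟧} (hg : AdicSummable g) {e : κ → ι}
    (he : Function.Injective e) : AdicSummable fun i => g (e i) := fun k =>
  (hg k).preimage he.injOn

theorem adicSum_sub {g h : ι → B⟦X⟧} (hg : AdicSummable g) (hh : AdicSummable h) :
    adicSum (fun i => g i - h i) = adicSum g - adicSum h := by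
  ext k
  simp only [map_sub, coeff_adicSum]
  exact finsum_sub_distrib (hg.coeff_finite k) (hh.coeff_finite k)

theorem adicSum_zero : adicSum (fun _ : ι => (0 : B⟦X⟧)) = 0 := by
  ext k
  simp [coeff_adicSum]

theorem AdicSummable.sum {α : Type*} {s : Finset α} {g : α → ι → B⟦X⟧}
    (hg : ∀ a ∈ s, AdicSummable (g a)) : AdicSummable fun i => ∑ a ∈ s, g a i := fun k =>
  (s.finite_toSet.biUnion fun a ha => hg a ha k).subset fun i hi => by
    by_contra h
    refine hi (Finset.dvd_sum fun a ha => ?_)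
    by_contra h'
    exact h (Set.mem_iUnion₂.2 ⟨a, ha, h'⟩)

theorem adicSum_sum {α : Type*} {s : Finset α} {g : α → ι → B⟦X⟧}
    (hg : ∀ a ∈ s, AdicSummable (g a)) :
    adicSum (fun i => ∑ a ∈ s, g a i) = ∑ a ∈ s, adicSum (g a) := by
  ext k
  simp only [map_sum, coeff_adicSum]
  exact finsum_sum_comm s _ fun a ha => (hg a ha).coeff_finite k

theorem adicSum_mul_left {g : ι → B⟦X⟧} (hg : AdicSummable g) (c : B⟦X⟧) :
    adicSum (fun i => c * g i) = c * adicSum g := by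
  ext k
  simp only [PowerSeries.coeff_mul, coeff_adicSum]
  rw [finsum_sum_comm]
  · refine Finset.sum_congr rfl fun x _ => ?_
    exact (mul_finsum' _ _ (hg.coeff_finite _)).symm
  · intro x _
    refine (hg.coeff_finite x.2).subset fun i hi hz => hi ?_
    have hz : PowerSeries.coeff x.2 (g i) = 0 := hz
    simp only [hz, mul_zero]

theorem adicSum_mul_right {g : ι → B⟦X⟧} (hg : AdicSummable g) (c : B⟦X⟧) :
    adicSum (fun i => g i * c) = adicSum g * c := by
  simp only [mul_comm _ c]
  exact adicSum_mul_left hg c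

theorem adicSum_eq_finsum {g : ι → B⟦X⟧} (hg : (Function.support g).Finite) :
    adicSum g = ∑ᶠ i, g i := by
  ext k
  rw [coeff_adicSum]
  exact ((PowerSeries.coeff k).toAddMonoidHom.map_finsum hg).symm

theorem pow_dvd_adicSum {g : ι → B⟦X⟧} {k : ℕ} (h : ∀ i, PowerSeries.X ^ k ∣ g i) :
    PowerSeries.X ^ k ∣ adicSum g := by
  rw [PowerSeries.X_pow_dvd_iff]
  intro m hm
  rw [coeff_adicSum]
  exact finsum_eq_zero_of_forall_eq_zero fun i => PowerSeries.X_pow_dvd_iff.1 (h i) m hm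

theorem adicSum_comm {g : ι → κ → B⟦X⟧} (hg : AdicSummable fun x : ι × κ => g x.1 x.2) :
    adicSum (fun i => adicSum (g i)) = adicSum fun j => adicSum fun i => g i j := by
  ext k
  simp only [coeff_adicSum]
  exact finsum_comm_of_finite (fun i j => PowerSeries.coeff k (g i j)) (hg.coeff_finite k)

theorem AdicSummable.adicSum_snd {g : ι → κ → B⟦X⟧}
    (hg : AdicSummable fun x : ι × κ => g x.1 x.2) :
    AdicSummable fun j => adicSum fun i => g i j := fun k =>
  ((hg k).image Prod.snd).subset fun j hj => by
    by_contra h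
    refine hj (pow_dvd_adicSum fun i => ?_)
    by_contra h'
    exact h ⟨(i, j), h', rfl⟩

theorem adicSum_comp_equiv (e : κ ≃ ι) (g : ι → B⟦X⟧) : adicSum (fun j => g (e j)) = adicSum g := by
  ext k
  simp only [coeff_adicSum]
  exact finsum_comp_equiv e (f := fun i => PowerSeries.coeff k (g i))

theorem pairing_eq_adicSum {R : Type*} [CommRing R] (U P : Fock 2 (GlueRing R)) :
    pairing U P = adicSum fun T => U T * P T := rfl

/-- Toggling `r` is an involution of the basis that keeps the sign, so the matrices of `ψ^*` and `ψ`
are transposes of each other. -/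
theorem pairing_psiStar {R : Type*} [CommRing R] (c : Fin 2) (r : ℤ) (U P : Fock 2 (GlueRing R)) :
    pairing (psiStar c r U) P = pairing U (psi c r P) := by
  let e : States 2 ≃ States 2 := ⟨fun T => toggle T c r, fun T => toggle T c r,
    fun T => toggle_toggle T c r, fun T => toggle_toggle T c r⟩
  rw [pairing_eq_adicSum, pairing_eq_adicSum, ← adicSum_comp_equiv e]
  congr 1
  funext T
  show psiStar c r U (toggle T c r) * P (toggle T c r) = _
  rw [psiStar_apply, psi_apply, toggle_toggle, sgn_toggle_self]
  have : r ∈ toggle T c r c ↔ r ∉ T c := by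
    rw [mem_toggle]
    simp
  by_cases h : r ∈ T c
  · rw [if_neg (by tauto), if_pos h]
    ring
  · rw [if_pos (by tauto), if_neg h]
    ring

end AdicSum

/-! ### Decay of the gluing vector -/

section Decay

variable {N : ℕ} {S : Type*} [CommRing S]

theorem dvd_finsum {α : Type*} {g : α → S} {d : S} (h : ∀ a, d ∣ g a) : d ∣ ∑ᶠ a, g a :=
  finsum_induction (d ∣ ·) (dvd_zero d) (fun _ _ => dvd_add) h

variable [Algebra ℂ S]

/-- The annihilator relation at `(i, m)` writes the coefficient as a sum in which every term has a
factor `A i j m n`. -/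
theorem dvd_bogoliubov_of_particle (A : Coeffs N S) {d : S} {i : Fin N} {m : ℕ}
    (h : ∀ j n, d ∣ A i j m n) {T : States N} (hm : (m : ℤ) ∈ T i) : d ∣ bogoliubov A T := by
  have h1 := congrFun (psiStar_bogoliubov A i m) (remove T i m)
  rw [psiStar_apply, if_neg (notMem_remove_self T i m), toggle,
    if_neg (notMem_remove_self T i m), add_remove T i m hm] at h1
  have h2 : bogoliubov A T = ((sgn (remove T i m) i m : ℤ) : S) *
      annih (fun j n => A i j m n) (bogoliubov A) (remove T i m) := by
    rw [← h1, ← mul_assoc, sgn_mul_self, one_mul]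
  rw [h2]
  exact (dvd_finsum fun x : Fin N × ℕ => (h x.1 x.2).mul_right _).mul_left _

theorem dvd_bogoliubov_of_hole (A : Coeffs N S) {d : S} {j : Fin N} {n : ℕ}
    (h : ∀ i m, d ∣ A i j m n) {T : States N} (hn : (-(n : ℤ) - 1) ∉ T j) :
    d ∣ bogoliubov A T := by
  have h1 := congrFun (psi_bogoliubov A j n) (add T j (-(n : ℤ) - 1))
  rw [psi_apply, if_pos (mem_add_self T j _), toggle, if_pos (mem_add_self T j _),
    remove_add T j _ hn] at h1
  have h2 : bogoliubov A T = ((sgn (add T j (-(n : ℤ) - 1)) j (-(n : ℤ) - 1) : ℤ) : S) *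
      creat (fun i m => - A i j m n) (bogoliubov A) (add T j (-(n : ℤ) - 1)) := by
    rw [← h1, ← mul_assoc, sgn_mul_self, one_mul]
  rw [h2]
  exact (dvd_finsum fun x : Fin N × ℕ => ((h x.1 x.2).neg_right).mul_right _).mul_left _

/-- Such a state agrees with the vacuum outside the window `[-k, k)` in each component. -/
theorem finite_states (N k : ℕ) :
    {U : States N | ∀ i (m : ℕ), k ≤ m → (m : ℤ) ∉ U i ∧ (-(m : ℤ) - 1) ∈ U i}.Finite := by
  refine Set.Finite.of_injOn (f := fun U i => (U i).carrier ∩ Set.Ico (-(k : ℤ)) k)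
    (t := Set.univ.pi fun _ => 𝒫 (Set.Ico (-(k : ℤ)) k)) ?_ ?_
    (Set.Finite.pi fun _ => (Set.finite_Ico _ _).powerset)
  · exact fun U _ i _ => Set.inter_subset_right
  · intro U hU U' hU' h
    refine States.ext fun i r => ?_
    by_cases hr : r ∈ Set.Ico (-(k : ℤ)) k
    · have h1 : r ∈ (U i).carrier ∩ Set.Ico (-(k : ℤ)) k ↔
          r ∈ (U' i).carrier ∩ Set.Ico (-(k : ℤ)) k := Set.ext_iff.1 (congrFun h i) r
      exact ⟨fun h' => (h1.1 ⟨h', hr⟩).1, fun h' => (h1.2 ⟨h', hr⟩).1⟩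
    · rw [Set.mem_Ico, not_and_or, not_le, not_lt] at hr
      rcases hr with hr | hr
      · obtain ⟨m, rfl⟩ : ∃ m : ℕ, r = -(m : ℤ) - 1 := ⟨(-r - 1).toNat, by omega⟩
        exact iff_of_true (hU i m (by omega)).2 (hU' i m (by omega)).2
      · lift r to ℕ using by omega
        exact iff_of_false (hU i r (by omega)).1 (hU' i r (by omega)).1

variable {R : Type*} [CommRing R] [Algebra ℂ R] (q : Rˣ) (f : ℤ)

theorem glueCoeffs_of_ne (i j : Fin 2) {m n : ℕ} (h : m ≠ n) : glueCoeffs q f i j m n = 0 := by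
  simp [glueCoeffs, h]

theorem dvd_glueCoeffs (i j : Fin 2) (m n : ℕ) :
    (PowerSeries.X : GlueRing R) ^ (m + 1) ∣ glueCoeffs q f i j m n := by
  have h : (PowerSeries.X : GlueRing R) ^ (m + 1) ∣ PowerSeries.X ^ (2 * n + 1) ∨ m ≠ n := by
    by_cases h : m = n
    · exact Or.inl (pow_dvd_pow _ (by omega))
    · exact Or.inr h
  rcases h with h | h
  · unfold glueCoeffs
    split_ifs
    · exact h.mul_right _
    · exact h.mul_right _
    · exact dvd_zero _
    · exact dvd_zero _
  · rw [glueCoeffs_of_ne q f i j h]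
    exact dvd_zero _

theorem dvd_glueVector_of_particle {U : States 2} {i : Fin 2} {m : ℕ} (h : (m : ℤ) ∈ U i) :
    (PowerSeries.X : GlueRing R) ^ (m + 1) ∣ glueVector q f U :=
  dvd_bogoliubov_of_particle _ (fun j n => dvd_glueCoeffs q f i j m n) h

theorem dvd_glueVector_of_hole {U : States 2} {i : Fin 2} {m : ℕ} (h : (-(m : ℤ) - 1) ∉ U i) :
    (PowerSeries.X : GlueRing R) ^ (m + 1) ∣ glueVector q f U := by
  refine dvd_bogoliubov_of_hole _ (fun j n => ?_) h
  by_cases hn : n = m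
  · subst hn
    exact dvd_glueCoeffs q f j i n n
  · rw [glueCoeffs_of_ne q f j i hn]
    exact dvd_zero _

/-- A particle or hole at depth `m ≥ k` forces divisibility by `X ^ k`, so only states of bounded
depth escape it. All convergence in the gluing comes from here, whatever the other argument of the
pairing is. -/
theorem adicSummable_glueVector : AdicSummable (glueVector q f) := fun k =>
  (finite_states 2 k).subset fun U hU i m hm => by
    constructor
    · exact fun h => hU ((pow_dvd_pow _ (by omega)).trans (dvd_glueVector_of_particle q f h))
    · by_contra h
      exact hU ((pow_dvd_pow _ (by omega)).trans (dvd_glueVector_of_hole q f h))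

theorem dvd_glueVector_of_ne {U : States 2} (h : U ≠ fun _ => Maya.vacuum) :
    (PowerSeries.X : GlueRing R) ∣ glueVector q f U := by
  by_contra hd
  refine h (States.ext fun i r => ?_)
  rw [mem_vacuum]
  constructor
  · intro hr
    by_contra hr'
    lift r to ℕ using by omega
    exact hd ((dvd_pow_self _ r.succ_ne_zero).trans (dvd_glueVector_of_particle q f hr))
  · intro hr
    by_contra hr'
    obtain ⟨m, rfl⟩ : ∃ m : ℕ, r = -(m : ℤ) - 1 := ⟨(-r - 1).toNat, by omega⟩
    exact hd ((dvd_pow_self _ m.succ_ne_zero).trans (dvd_glueVector_of_hole q f hr'))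

theorem pairingConverges_glueVector (U : Fock 2 (GlueRing R)) :
    PairingConverges U (glueVector q f) :=
  ((adicSummable_glueVector q f).mul_left U).coeff_finite

/-- The gluing coefficients are diagonal in `m, n`, so the infinite sum collapses to the two
components. -/
theorem psi_glueVector (c : Fin 2) (n : ℕ) :
    psi c (-(n : ℤ) - 1) (glueVector q f) =
      - ∑ d, glueCoeffs q f d c n n • psi d (n : ℤ) (glueVector q f) := by
  rw [glueVector, psi_bogoliubov, creat_apply]
  ext1 U
  have e : Function.Injective fun d : Fin 2 => (d, n) := fun _ _ h => (Prod.ext_iff.1 h).1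
  refine (finsum_eq_finsum_comp e ?_).trans ?_
  · rintro ⟨d, m⟩ h
    by_cases hm : m = n
    · exact ⟨d, by rw [hm]⟩
    · simp [glueCoeffs_of_ne q f d c hm] at h
  · rw [finsum_eq_sum_of_fintype]
    simp [add_comm]

end Decay

/-! ### Self-gluing -/

section Append

variable {M : ℕ}

theorem mem_append_castAdd {T : States M} {U : States 2} {i : Fin M} {r : ℤ} :
    r ∈ (Fin.append T U : States (M + 2)) (Fin.castAdd 2 i) ↔ r ∈ T i := by
  rw [Fin.append_left]

theorem mem_append_natAdd {T : States M} {U : States 2} {c : Fin 2} {r : ℤ} :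
    r ∈ (Fin.append T U : States (M + 2)) (Fin.natAdd M c) ↔ r ∈ U c := by
  rw [Fin.append_right]

theorem castAdd_ne_natAdd (i : Fin M) (c : Fin 2) : Fin.castAdd 2 i ≠ Fin.natAdd M c := by
  intro h
  have := congrArg Fin.val h
  simp at this
  omega

theorem toggle_append_castAdd (T : States M) (U : States 2) (i : Fin M) (r : ℤ) :
    toggle (Fin.append T U : States (M + 2)) (Fin.castAdd 2 i) r =
      (Fin.append (toggle T i r) U : States (M + 2)) :=
  States.ext fun j s => by
    induction j using Fin.addCases with
    | left j => simp [mem_toggle]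
    | right c => simp [mem_toggle, castAdd_ne_natAdd]

theorem toggle_append_natAdd (T : States M) (U : States 2) (c : Fin 2) (r : ℤ) :
    toggle (Fin.append T U : States (M + 2)) (Fin.natAdd M c) r =
      (Fin.append T (toggle U c r) : States (M + 2)) :=
  States.ext fun j s => by
    induction j using Fin.addCases with
    | left j => simp [mem_toggle, (castAdd_ne_natAdd _ _).symm]
    | right c => simp [mem_toggle]

theorem sgn_append_castAdd (T : States M) (U : States 2) (i : Fin M) (r : ℤ) :
    sgn (Fin.append T U : States (M + 2)) (Fin.castAdd 2 i) r = sgn T i r := by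
  unfold sgn
  rw [Iio_eq_filter_univ, Iio_eq_filter_univ, Finset.sum_filter, Finset.sum_filter,
    Fin.sum_univ_add, Fin.append_left,
    Finset.sum_eq_zero (s := (Finset.univ : Finset (Fin 2))), add_zero]
  · simp only [Fin.append_left]
    rfl
  · intro c _
    refine if_neg ?_
    rw [Fin.lt_def, Fin.val_natAdd, Fin.val_castAdd]
    omega

theorem sgn_append_natAdd (T : States M) (U : States 2) (c : Fin 2) (r : ℤ) :
    sgn (Fin.append T U : States (M + 2)) (Fin.natAdd M c) r =
      Int.negOnePow (∑ i, (T i).charge) * sgn U c r := by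
  unfold sgn
  rw [← Int.negOnePow_add, Iio_eq_filter_univ, Iio_eq_filter_univ,
    Finset.sum_filter, Finset.sum_filter, Fin.sum_univ_add,
    Fin.append_right, ← add_assoc]
  congr 3
  · refine Finset.sum_congr rfl fun i _ => ?_
    rw [if_pos (by rw [Fin.lt_def, Fin.val_natAdd, Fin.val_castAdd]; omega), Fin.append_left]
  · refine Finset.sum_congr rfl fun d _ => ?_
    rw [Fin.append_right]
    congr 1
    rw [eq_iff_iff, Fin.lt_def, Fin.lt_def, Fin.val_natAdd, Fin.val_natAdd]
    omega

variable {R : Type*} [CommRing R]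

theorem slice_psiStar_castAdd (V : Fock (M + 2) (GlueRing R)) (i : Fin M) (r : ℤ) (T : States M) :
    slice (psiStar (Fin.castAdd 2 i) r V) T =
      if r ∈ T i then 0 else ((sgn T i r : ℤ) : GlueRing R) • slice V (toggle T i r) := by
  funext U
  simp only [slice, psiStar_apply, mem_append_castAdd, toggle_append_castAdd, sgn_append_castAdd]
  split_ifs <;> rfl

theorem slice_psiStar_natAdd (V : Fock (M + 2) (GlueRing R)) (c : Fin 2) (r : ℤ) (T : States M) :
    slice (psiStar (Fin.natAdd M c) r V) T =
      ((Int.negOnePow (∑ i, (T i).charge) : ℤ) : GlueRing R) • psiStar c r (slice V T) := by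
  funext U
  simp only [slice, psiStar_apply, mem_append_natAdd, toggle_append_natAdd, sgn_append_natAdd,
    Pi.smul_apply, Units.val_mul, Int.cast_mul, smul_eq_mul]
  split_ifs
  · rw [mul_zero]
  · rw [mul_assoc]

theorem particles_append (T : States M) (U : States 2) :
    particles (Fin.append T U : States (M + 2)) = particles T + particles U := by
  simp [particles, Fin.sum_univ_add]

theorem append_vacuum : (Fin.append (fun _ : Fin M => Maya.vacuum) fun _ : Fin 2 => Maya.vacuum) =
    (fun _ => Maya.vacuum : States (M + 2)) := by
  funext i
  induction i using Fin.addCases <;> simp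

end Append

/-! ### The self-gluing map and its relations -/

section Gluing

variable {M : ℕ} {R : Type*} [CommRing R] [Algebra ℂ R] (q : Rˣ) (f : ℤ)

theorem selfGluing_eq_adicSum (V : Fock (M + 2) (GlueRing R)) (T : States M) :
    selfGluing q f V T = adicSum fun U => V (Fin.append T U) * glueVector q f U := rfl

theorem pairing_smul_left (c : GlueRing R) (U : Fock 2 (GlueRing R)) :
    pairing (c • U) (glueVector q f) = c * pairing U (glueVector q f) := by
  rw [pairing_eq_adicSum, pairing_eq_adicSum,
    ← adicSum_mul_left ((adicSummable_glueVector q f).mul_left U)]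
  simp only [Pi.smul_apply, smul_eq_mul, mul_assoc]

/-- The external components precede `a` and `b`, so the signs are independent of the states summed
over. -/
theorem selfGluing_psiStar_castAdd (V : Fock (M + 2) (GlueRing R)) (i : Fin M) (r : ℤ) :
    selfGluing q f (psiStar (Fin.castAdd 2 i) r V) = psiStar i r (selfGluing q f V) := by
  funext T
  rw [psiStar_apply, selfGluing, slice_psiStar_castAdd]
  split_ifs with h
  · simp [pairing_eq_adicSum, adicSum_zero]
  · rw [pairing_smul_left]
    rfl

/-- The adjoint of `ψ^{c*}_{-n}` meets the dual relation of the gluing vector. The sign of passing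
the external components is common to both sides. -/
theorem selfGluing_psiStar_hole (V : Fock (M + 2) (GlueRing R)) (c : Fin 2) (n : ℕ) :
    selfGluing q f (psiStar (Fin.natAdd M c) (-(n : ℤ) - 1) V) =
      - ∑ d, glueCoeffs q f d c n n • selfGluing q f (psiStar (Fin.natAdd M d) (n : ℤ) V) := by
  funext T
  -- Up to signs and zeros, `ψ` only permutes the coefficients of the gluing vector, so adic decay
  -- persists.
  have hsum : ∀ d : Fin 2, AdicSummable fun U =>
      slice V T U * psi d (n : ℤ) (glueVector q f) U := fun d => by
    have h1 : AdicSummable fun U => glueVector q f (toggle U d (n : ℤ)) :=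
      (adicSummable_glueVector q f).comp_injective
        (e := fun U => toggle U d (n : ℤ))
        (Function.Involutive.injective fun U => toggle_toggle U d (n : ℤ))
    refine h1.mono fun U => ?_
    rw [psi_apply]
    split_ifs
    · exact Dvd.intro_left _ (by rw [← mul_assoc])
    · rw [mul_zero]
      exact dvd_zero _
  have h2 : pairing (slice V T) (psi c (-(n : ℤ) - 1) (glueVector q f)) =
      ∑ d, - glueCoeffs q f d c n n * pairing (slice V T) (psi d (n : ℤ) (glueVector q f)) := by
    simp only [pairing_eq_adicSum]
    rw [psi_glueVector]
    simp only [← adicSum_mul_left (hsum _)]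
    rw [← adicSum_sum fun d _ => (hsum d).mul_left _]
    congr 1
    funext U
    simp only [Pi.neg_apply, Finset.sum_apply, Pi.smul_apply, smul_eq_mul]
    rw [mul_neg, Finset.mul_sum, ← Finset.sum_neg_distrib]
    refine Finset.sum_congr rfl fun d _ => ?_
    ring
  simp only [Pi.neg_apply, Finset.sum_apply, Pi.smul_apply, smul_eq_mul]
  simp only [selfGluing, slice_psiStar_natAdd, pairing_smul_left, pairing_psiStar]
  rw [h2, Finset.mul_sum, ← Finset.sum_neg_distrib]
  exact Finset.sum_congr rfl fun d _ => by ring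

/-- The joint convergence of the pairing and of the sum over the removed hole. -/
theorem adicSummable_psiStar_pair (V : Fock (M + 2) (GlueRing R)) (T : States M) :
    AdicSummable fun x : States 2 × (Fin (M + 2) × ℕ) =>
      psiStar x.2.1 (-(x.2.2 : ℤ) - 1) V (Fin.append T x.1) * glueVector q f x.1 := by
  intro k
  have key : ∀ (U : States 2) (x : Fin (M + 2) × ℕ),
      ¬ PowerSeries.X ^ k ∣ psiStar x.1 (-(x.2 : ℤ) - 1) V (Fin.append T U) * glueVector q f U →
      ¬ PowerSeries.X ^ k ∣ glueVector q f U ∧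
        (-(x.2 : ℤ) - 1) ∉ (Fin.append T U : States (M + 2)) x.1 := by
    intro U x h
    refine ⟨fun h' => h (dvd_mul_of_dvd_right h' _), fun h' => h ?_⟩
    rw [psiStar_apply, if_pos h', zero_mul]
    exact dvd_zero _
  have hfin := (adicSummable_glueVector q f k).biUnion fun U _ =>
    (holes_set_finite (Fin.append T U : States (M + 2))).image (Prod.mk U)
  refine hfin.subset fun x hx => ?_
  obtain ⟨h1, h2⟩ := key x.1 x.2 hx
  exact Set.mem_biUnion (x := x.1) h1 ⟨x.2, h2, rfl⟩

theorem adicSummable_selfGluing_psiStar (V : Fock (M + 2) (GlueRing R)) (T : States M) :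
    AdicSummable fun x : Fin (M + 2) × ℕ =>
      selfGluing q f (psiStar x.1 (-(x.2 : ℤ) - 1) V) T :=
  AdicSummable.adicSum_snd
    (g := fun (U : States 2) (x : Fin (M + 2) × ℕ) =>
      psiStar x.1 (-(x.2 : ℤ) - 1) V (Fin.append T U) * glueVector q f U)
    (adicSummable_psiStar_pair q f V T)

theorem selfGluing_annih (B : Fin (M + 2) → ℕ → GlueRing R) (V : Fock (M + 2) (GlueRing R))
    (T : States M) : selfGluing q f (annih B V) T =
      adicSum fun x : Fin (M + 2) × ℕ =>
        B x.1 x.2 * selfGluing q f (psiStar x.1 (-(x.2 : ℤ) - 1) V) T := by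
  have hpair := (adicSummable_psiStar_pair q f V T).mul_left fun x => B x.2.1 x.2.2
  have h1 : ∀ U : States 2, annih B V (Fin.append T U) * glueVector q f U =
      adicSum fun x : Fin (M + 2) × ℕ => B x.1 x.2 *
        (psiStar x.1 (-(x.2 : ℤ) - 1) V (Fin.append T U) * glueVector q f U) := fun U => by
    have hfin := ((locallyFin_psiStar V).smul fun x => B x.1 x.2)
      (Fin.append T U : States (M + 2))
    simp only [← mul_assoc]
    rw [annih_apply, lsum, ← adicSum_eq_finsum hfin,
      ← adicSum_mul_right (adicSummable_of_finite hfin)]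
    rfl
  rw [selfGluing_eq_adicSum]
  simp only [h1]
  rw [adicSum_comm hpair]
  congr 1
  funext x
  rw [adicSum_mul_left ((adicSummable_glueVector q f).mul_left _)]
  rfl

/-- At the external vacuum the operators `ψ^{j*}_{-n}` with `j` external give zero, as there are no
holes to fill. The remaining relations are those of the `a, b` block, and `eq_smul_bogoliubov`
identifies the slice. -/
theorem slice_bogoliubov_vacuum (A : Coeffs (M + 2) (GlueRing R)) :
    slice (bogoliubov A) (fun _ : Fin M => Maya.vacuum) = bogoliubov (restrictAB A) := by
  set T : States M := fun _ => Maya.vacuum with hT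
  have h0 : slice (bogoliubov A) T (fun _ => Maya.vacuum) = 1 := by
    rw [slice, hT, append_vacuum, bogoliubov_vacuum]
  have hstar : ∀ (c : Fin 2) (r : ℤ), slice (psiStar (Fin.natAdd M c) r (bogoliubov A)) T =
      psiStar c r (slice (bogoliubov A) T) := fun c r => by
    rw [slice_psiStar_natAdd]
    simp [hT, Maya.charge, Maya.vacuum]
  rw [eq_smul_bogoliubov (restrictAB A) (slice (bogoliubov A) T), h0, one_smul]
  · intro c m
    rw [← hstar, psiStar_bogoliubov, annih_apply, annih_apply]
    funext U
    have e : Function.Injective fun x : Fin 2 × ℕ => (Fin.natAdd M x.1, x.2) := by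
      rintro ⟨_, _⟩ ⟨_, _⟩ h
      simpa using h
    refine (finsum_eq_finsum_comp e ?_).trans ?_
    · rintro ⟨j, n⟩ h
      induction j using Fin.addCases with
      | left j =>
        refine absurd ?_ h
        show A _ _ _ _ * psiStar _ _ _ _ = 0
        rw [psiStar_apply, if_pos, mul_zero]
        rw [mem_append_castAdd, hT, mem_vacuum]
        omega
      | right d => exact ⟨(d, n), rfl⟩
    · refine finsum_congr fun x => ?_
      simp only [← hstar]
      rfl
  · intro U hU hp
    refine bogoliubov_eq_zero_of_particles A ?_ fun h => hU (funext fun c => ?_)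
    · rw [particles_append, hp, hT, particles_vacuum]
    · have := congrFun h (Fin.natAdd M c)
      rwa [Fin.append_right] at this

theorem selfGluing_bogoliubov_vacuum (A : Coeffs (M + 2) (GlueRing R)) :
    selfGluing q f (bogoliubov A) (fun _ => Maya.vacuum) = closedPart q f A := by
  rw [selfGluing, slice_bogoliubov_vacuum, closedPart]

/-- Modulo `X` the gluing vector is the vacuum, so the constant coefficient is `1`. -/
theorem isUnit_closedPart (A : Coeffs (M + 2) (GlueRing R)) : IsUnit (closedPart q f A) := by
  rw [PowerSeries.isUnit_iff_constantCoeff]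
  have : PowerSeries.constantCoeff (closedPart q f A) = 1 := by
    rw [← PowerSeries.coeff_zero_eq_constantCoeff_apply, closedPart, pairing_eq_adicSum,
      coeff_adicSum, finsum_eq_single _ (fun _ => Maya.vacuum)]
    · rw [glueVector, bogoliubov_vacuum, bogoliubov_vacuum]
      simp
    · intro U hU
      have h : PowerSeries.X ^ 1 ∣ bogoliubov (restrictAB A) U * glueVector q f U := by
        rw [pow_one]
        exact (dvd_glueVector_of_ne q f hU).mul_left _
      exact PowerSeries.X_pow_dvd_iff.1 h 0 one_pos
  rw [this]
  exact isUnit_one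

/-- Both the transform and the gluing vector are supported in total charge zero, so the result is
too; a neutral state without particles is the vacuum. -/
theorem selfGluing_bogoliubov_eq_zero (A : Coeffs (M + 2) (GlueRing R)) {T : States M}
    (hT : T ≠ fun _ => Maya.vacuum) (hp : particles T = 0) :
    selfGluing q f (bogoliubov A) T = 0 := by
  rw [selfGluing_eq_adicSum, ← adicSum_zero (ι := States 2)]
  congr 1
  funext U
  by_contra h
  refine hT (eq_vacuum_of_neutral hp ?_)
  have h1 : ∑ i, ((Fin.append T U : States (M + 2)) i).charge = 0 :=
    charge_of_bogoliubov_ne_zero (left_ne_zero_of_mul h)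
  have h2 : ∑ i, (U i).charge = 0 := charge_of_bogoliubov_ne_zero (right_ne_zero_of_mul h)
  simp only [Fin.sum_univ_add, Fin.append_left, Fin.append_right] at h1
  rw [h2] at h1
  simpa using h1

end Gluing

/-! ### The self-gluing of a Bogoliubov transform is a Bogoliubov transform -/

section Main

variable {M : ℕ}

/-! ### Reading off annihilator coefficients at one-hole states -/

section Projection

variable {S : Type*} [CommRing S]

/-- The state with a single hole, at `-(n + 1/2)` in the `j`-th component. -/
def holeState (x : Fin M × ℕ) : States M := toggle (fun _ => Maya.vacuum) x.1 (-(x.2 : ℤ) - 1)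

/-- The sign with which `ψ^{j*}_{-(n+1/2)}` acts on the vacuum. -/
def holeSign (x : Fin M × ℕ) : ℤˣ := sgn (fun _ : Fin M => Maya.vacuum) x.1 (-(x.2 : ℤ) - 1)

theorem psiStar_holeState_self (W : Fock M S) (x : Fin M × ℕ) :
    psiStar x.1 (-(x.2 : ℤ) - 1) W (holeState x) =
      ((holeSign x : ℤ) : S) * W fun _ => Maya.vacuum := by
  rw [psiStar_apply, holeState, toggle_toggle, sgn_toggle_self, if_neg]
  · rfl
  · rw [mem_toggle, mem_vacuum]
    simp only [and_self, not_true_eq_false, iff_false, not_not]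
    omega

theorem psiStar_holeState_of_ne (W : Fock M S) {x y : Fin M × ℕ} (h : x ≠ y) :
    psiStar x.1 (-(x.2 : ℤ) - 1) W (holeState y) = 0 := by
  rw [psiStar_apply, if_pos]
  rw [holeState, mem_toggle, mem_vacuum]
  refine iff_of_true (by omega) fun h' => h ?_
  exact Prod.ext h'.1.symm (by omega)

/-- The holes of a state. -/
def holes (T : States M) : Finset (Fin M × ℕ) := (holes_set_finite T).toFinset

theorem mem_holes {T : States M} {x : Fin M × ℕ} :
    x ∈ holes T ↔ (-(x.2 : ℤ) - 1) ∉ T x.1 := Set.Finite.mem_toFinset _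

/-- The coefficient at `T` of `Z - ∑_x c_x ψ*_x W`, where `c_x` is `± W(vac)⁻¹` times the coefficient
of `Z` at the state with a single hole at `x`. -/
def holeDefect (W : Fock M S) (T : States M) : Fock M S →ₗ[S] S :=
  LinearMap.proj T - ∑ x ∈ holes T,
    (Ring.inverse (W fun _ => Maya.vacuum) * ((holeSign x : ℤ) : S) *
      psiStar x.1 (-(x.2 : ℤ) - 1) W T) • LinearMap.proj (holeState x)

theorem holeDefect_apply (W : Fock M S) (T : States M) (Z : Fock M S) :
    holeDefect W T Z = Z T - ∑ x ∈ holes T,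
      (Ring.inverse (W fun _ => Maya.vacuum) * ((holeSign x : ℤ) : S) *
        psiStar x.1 (-(x.2 : ℤ) - 1) W T) * Z (holeState x) := by
  simp [holeDefect]

/-- At the one-hole states the vectors `ψ^*_x W` form a diagonal matrix with entries `± W(vac)`, so
the coefficients read off from `ψ^*_x W` are those of `ψ^*_x W` itself. -/
theorem holeDefect_psiStar (W : Fock M S) (hW : IsUnit (W fun _ => Maya.vacuum)) (T : States M)
    (x : Fin M × ℕ) : holeDefect W T (psiStar x.1 (-(x.2 : ℤ) - 1) W) = 0 := by
  rw [holeDefect_apply, sub_eq_zero]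
  by_cases hx : x ∈ holes T
  · rw [Finset.sum_eq_single_of_mem x hx fun y _ hy => by
      rw [psiStar_holeState_of_ne W hy.symm, mul_zero], psiStar_holeState_self]
    have h1 : ((holeSign x : ℤ) : S) * ((holeSign x : ℤ) : S) = 1 := sgn_mul_self _ _ _ _
    have h2 := Ring.inverse_mul_cancel _ hW
    linear_combination (-(psiStar x.1 (-(x.2 : ℤ) - 1) W T)) * h2 -
      (Ring.inverse (W fun _ => Maya.vacuum) * (W fun _ => Maya.vacuum) *
        psiStar x.1 (-(x.2 : ℤ) - 1) W T) * h1
  · have hx' : (-(x.2 : ℤ) - 1) ∈ T x.1 := by_contra fun h => hx (mem_holes.2 h)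
    rw [psiStar_apply, if_pos hx']
    refine (Finset.sum_eq_zero fun y hy => ?_).symm
    rw [psiStar_holeState_of_ne, mul_zero]
    rintro rfl
    exact hx hy

theorem holeDefect_eq_sub_annih (W Z : Fock M S) (T : States M) :
    holeDefect W T Z = Z T - annih (fun j n => Ring.inverse (W fun _ => Maya.vacuum) *
      ((holeSign (j, n) : ℤ) : S) * Z (holeState (j, n))) W T := by
  rw [holeDefect_apply, annih_apply, lsum]
  congr 1
  rw [finsum_eq_sum_of_support_subset (s := holes T)]
  · refine Finset.sum_congr rfl fun x _ => ?_
    simp only [Pi.smul_apply, smul_eq_mul]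
    ring
  · intro x hx
    rw [Finset.mem_coe, mem_holes]
    refine fun h => hx ?_
    show _ * psiStar x.1 (-(x.2 : ℤ) - 1) W T = 0
    rw [psiStar_apply, if_pos h, mul_zero]

/-- Only the finitely many holes of `T` enter the functional, so it passes through convergent sums.
-/
theorem holeDefect_adicSum {B : Type*} [CommRing B] {ι : Type*} (W : Fock M B⟦X⟧) (T : States M)
    (a : ι → B⟦X⟧) {Z : ι → Fock M B⟦X⟧} (hZ : ∀ U, AdicSummable fun x => Z x U) :
    holeDefect W T (fun U => adicSum fun x => a x * Z x U) =
      adicSum fun x => a x * holeDefect W T (Z x) := by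
  simp only [holeDefect_apply]
  have h1 : ∀ U, AdicSummable fun x => a x * Z x U := fun U => (hZ U).mul_left a
  simp only [← adicSum_mul_left (h1 _)]
  rw [← adicSum_sum fun y _ => (h1 _).mul_left _, ← adicSum_sub]
  · congr 1
    funext x
    rw [mul_sub, Finset.mul_sum]
    simp only [mul_left_comm (a x)]
  · exact h1 T
  · exact AdicSummable.sum fun y _ => (h1 _).mul_left _

end Projection

variable {R : Type*} [CommRing R] [Algebra ℂ R] (q : Rˣ) (f : ℤ)

/-- The coefficients are forced by evaluation at one-hole states. That they suffice means that every
`holeDefect` vanishes, which is shown modulo each power of `X`. -/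
theorem psiStar_selfGluing_bogoliubov (A : Coeffs (M + 2) (GlueRing R)) (i : Fin M) (m : ℕ) :
    psiStar i (m : ℤ) (selfGluing q f (bogoliubov A)) =
      annih (fun j n => Ring.inverse (closedPart q f A) * ((holeSign (j, n) : ℤ) : GlueRing R) *
        psiStar i (m : ℤ) (selfGluing q f (bogoliubov A)) (holeState (j, n)))
        (selfGluing q f (bogoliubov A)) := by
  set V := bogoliubov A with hV
  set W := selfGluing q f V with hWdef
  have hvac : (W fun _ => Maya.vacuum) = closedPart q f A := selfGluing_bogoliubov_vacuum q f A
  have hunit : IsUnit (W fun _ => Maya.vacuum) := by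
    rw [hvac]
    exact isUnit_closedPart q f A
  funext T
  rw [← hvac, ← sub_eq_zero, ← holeDefect_eq_sub_annih, ← selfGluing_psiStar_castAdd]
  -- Particle operators, on any component including `a` and `b`, reduce to hole operators by the
  -- relations of `V`.
  have hpart : ∀ (i : Fin (M + 2)) (m : ℕ),
      holeDefect W T (selfGluing q f (psiStar i (m : ℤ) V)) =
        adicSum fun x : Fin (M + 2) × ℕ => A i x.1 m x.2 *
          holeDefect W T (selfGluing q f (psiStar x.1 (-(x.2 : ℤ) - 1) V)) := fun i m => by
    rw [← holeDefect_adicSum W T _ (adicSummable_selfGluing_psiStar q f V)]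
    congr 1
    funext U
    rw [hV, psiStar_bogoliubov, selfGluing_annih]
  -- External hole operators have zero defect. Those on `a, b` pass through the gluing relation,
  -- gaining a factor `X`, and then return to hole operators by `hpart`, which closes the induction.
  have hhole : ∀ (k : ℕ) (x : Fin (M + 2) × ℕ), (PowerSeries.X : GlueRing R) ^ k ∣
      holeDefect W T (selfGluing q f (psiStar x.1 (-(x.2 : ℤ) - 1) V)) := by
    intro k
    induction k with
    | zero => exact fun x => by rw [pow_zero]; exact one_dvd _
    | succ k ih =>
      rintro ⟨j, n⟩
      induction j using Fin.addCases with
      | left j =>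
        have h := holeDefect_psiStar W hunit T (j, n)
        rw [hWdef, ← selfGluing_psiStar_castAdd, ← hWdef] at h
        rw [h]
        exact dvd_zero _
      | right c =>
        rw [selfGluing_psiStar_hole, map_neg, map_sum]
        refine (Finset.dvd_sum fun d _ => ?_).neg_right
        rw [map_smul, smul_eq_mul, pow_succ']
        refine mul_dvd_mul ((dvd_pow_self _ n.succ_ne_zero).trans (dvd_glueCoeffs q f d c n n)) ?_
        rw [hpart]
        exact pow_dvd_adicSum fun x => (ih x).mul_left _
  refine PowerSeries.ext fun k => ?_
  rw [map_zero]
  refine PowerSeries.X_pow_dvd_iff.1 ?_ k k.lt_succ_self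
  rw [hpart]
  exact pow_dvd_adicSum fun x => (hhole _ x).mul_left _

theorem isBogoliubov_normalizedSelfGluing (A : Coeffs (M + 2) (GlueRing R)) :
    IsBogoliubov (normalizedSelfGluing q f (bogoliubov A) A) := by
  have h := eq_smul_bogoliubov _ (selfGluing q f (bogoliubov A))
    (psiStar_selfGluing_bogoliubov q f A)
    (fun T hT hp => selfGluing_bogoliubov_eq_zero q f A hT hp)
  rw [selfGluing_bogoliubov_vacuum] at h
  obtain ⟨A', h'⟩ : ∃ A', selfGluing q f (bogoliubov A) = closedPart q f A • bogoliubov A' := ⟨_, h⟩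
  refine ⟨A', ?_⟩
  rw [normalizedSelfGluing, h', smul_smul, Ring.inverse_mul_cancel _ (isUnit_closedPart q f A),
    one_smul]

theorem selfGluing_properties (A : Coeffs (M + 2) (GlueRing R)) :
    (∀ T : States M, PairingConverges (slice (bogoliubov A) T) (glueVector q f)) ∧
      PairingConverges (bogoliubov (restrictAB A)) (glueVector q f) ∧
      IsUnit (closedPart q f A) ∧
      IsBogoliubov (normalizedSelfGluing q f (bogoliubov A) A) :=
  ⟨fun _ => pairingConverges_glueVector q f _, pairingConverges_glueVector q f _,
    isUnit_closedPart q f A, isBogoliubov_normalizedSelfGluing q f A⟩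

end Main

end FermionGluing

end

/-! ### The main theorem -/

open FermionGluing in
theorem mainTheorem6 {R : Type*} [CommRing R] [Algebra ℂ R] (q : Rˣ) (f : ℤ) (M N : ℕ) :
    (∀ (V : Fock (M + 2) (GlueRing R)) (A : Coeffs (M + 2) (GlueRing R)), V = bogoliubov A →
      (∀ T : States M, PairingConverges (slice V T) (glueVector q f)) ∧
      PairingConverges (bogoliubov (restrictAB A)) (glueVector q f) ∧
      IsUnit (closedPart q f A) ∧
      IsBogoliubov (normalizedSelfGluing q f V A)) ∧
    (∀ (V₁ : Fock (M + 1) (GlueRing R)) (A₁ : Coeffs (M + 1) (GlueRing R))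
      (V₂ : Fock (N + 1) (GlueRing R)) (A₂ : Coeffs (N + 1) (GlueRing R)),
      V₁ = bogoliubov A₁ → V₂ = bogoliubov A₂ →
      tensor V₁ V₂ = bogoliubov (blockCoeffs A₁ A₂) ∧
      (∀ T : States (M + N), PairingConverges (slice (tensor V₁ V₂) T) (glueVector q f)) ∧
      PairingConverges (bogoliubov (restrictAB (blockCoeffs A₁ A₂))) (glueVector q f) ∧
      IsUnit (closedPart q f (blockCoeffs A₁ A₂)) ∧
      IsBogoliubov (normalizedSelfGluing q f (tensor V₁ V₂) (blockCoeffs A₁ A₂))) := by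
  refine ⟨?_, ?_⟩
  · rintro V A rfl
    exact selfGluing_properties q f A
  · rintro V₁ A₁ V₂ A₂ rfl rfl
    refine ⟨tensor_bogoliubov A₁ A₂, ?_⟩
    rw [tensor_bogoliubov]
    exact selfGluing_properties q f (blockCoeffs A₁ A₂)
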